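/- Fix $k\ge 2$. Let $x_n=0$ for $-k+2\le n\le 0$, $x_1=1$, $x_n=x_{n-1}+\dots+x_{n-k}$ be the $k$-bonacci numbers. Let $X_n\in\mathbb Z^{k-1}$ be the $k$-bonacci vectors: $X_0=0$, $X_{-i}=e_i$ for $1\le i\le k-1$, and $X_n=X_{n-1}+\dots+X_{n-k}$ for all $n\in\mathbb Z$; so $X_{-k}=(-1,\dots,-1)$. For $v\in\mathbb Z^{k-1}\setminus\{0\}$ the *large steps algorithm* is the following. 1. *Large steps.* Put $v_1=v$. Given $v_i$, choose $n_i\ge 1$ such that $\|v_i-X_{-n_i}\|_2$ is minimal (ties are broken arbitrarily) and put $v_{i+1}=v_i-X_{-n_i}$. Stop at the first $i=M$ with $\|v_{M+1}\|_2\ge\|v_M\|_2$, and write $v_M$ as a sum of $X_{-1},\dots,X_{-k}$ in the obvious way: $|\mu|$ times $X_{-k}$ and $(v_M)_i-\mu$ times $X_{-i}$ for $1\le i\le k-1$, where $\mu$ is the smaller of $0$ and the least entry of $v_M$. This gives a decomposition $v=\sum_{i=1}^N X_{-n_i}$. Let $j_{lsb}=k(N-1)+\max_i n_i$. (The closest vectors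 are found by searching a precomputed table of the $X_{-n}$ with $\|X_{-n}\|_2\le 2\|v\|_2$.) 2. *Vector Zeckendorf greedy algorithm* with $j=j_{lsb}$. Compute $x_1,\dots,x_{j+1}$. Compute $S_{j+1}(v)=v\cdot(x_j,x_{j-1},\dots,x_{j+1-(k-1)})\bmod x_{j+1}$, where the reduction is done by repeated subtraction or addition of $x_{j+1}$. Write $S_{j+1}(v)=\sum_{i=1}^j c_i x_{j+1-i}$ with $c_i\in\{0,1\}$ and no $k$ consecutive $c_i$ equal to $1$ by the greedy algorithm, and output $\sum_{i=1}^j c_iX_{-i}$. Running time is the number of elementary operations (additions, subtractions, multiplications and comparisons of integers, and list operations, each at unit cost). Then, with constants that depend only on $k$ (and on $c$ in (b)) and not on how ties are broken, this algorithm can be carried out so that: (a) The whole algorithm takes $O(\|v\|_\infty)$ operations, for all $v\ne 0$. (b) Where $j_{lsb}=O(\log\|v\|_\infty)$, computing $j_{lsb}$ takes $O((\log\|v\|_\infty)^2)$ operations: for each $c$ there is $C$ such that for all $v$ with $\|v\|_\infty\ge 2$ and $j_{lsb}\le c\log\|v\|_\infty$, the computation of $j_{lsb}$ takes at most $C(\log\|v\|_\infty)^2$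 operations. (c) If $k\in\{2,3\}$, then computing $j_{lsb}$ takes $O((\log\|v\|_\infty)^2)$ operations, for all $v$ with $\|v\|_\infty\ge 2$. -/

import Mathlib

/-! ### `k`-bonacci numbers and vectors -/

namespace LargeSteps

/-- Vectors of `ℤ^{k-1}`; the coordinate `v_{i+1}` of the vector is `v i`. The Mathlib norm `‖v‖` on
this type is the sup norm. -/
abbrev Vec (k : ℕ) : Type := Fin (k - 1) → ℤ

/-- The `k`-bonacci number `x_n` for `n ≥ 0`: `x_1 = 1` and `x_n = x_{n-1} + ⋯ + x_{n-k}`, where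
`x_n = 0` for `-k+2 ≤ n ≤ 0`. The subtraction is truncated, so that an index that would be
nonpositive becomes `0`, and `x_0 = 0` is the right value there. -/
def bonacciNum (k : ℕ) : ℕ → ℤ
  | 0 => 0
  | 1 => 1
  | n + 2 => ∑ i ∈ Finset.range k, bonacciNum k (n + 1 - i)
termination_by n => n

/-- `bonacciVec k n` is the `k`-bonacci vector `X_{-n}` for `n ≥ 0`: `X_0 = 0`, `X_{-n} = e_n` for
`1 ≤ n ≤ k-1`, and the recurrence `X_m = X_{m-1} + ⋯ + X_{m-k}`, solved for its last term with
`m = k - n`: `X_{-n} = X_{-(n-k)} - (X_{-(n-1)} + ⋯ + X_{-(n-k+1)})` for `n ≥ k`.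
(The value for `k = 0` is irrelevant.) -/
def bonacciVec (k : ℕ) (n : ℕ) : Vec k :=
  if h0 : n = 0 ∨ k = 0 then 0
  else if hn : n < k then Pi.single (⟨n - 1, by omega⟩ : Fin (k - 1)) 1
  else bonacciVec k (n - k) - ∑ i ∈ Finset.range (k - 1), bonacciVec k (n - 1 - i)
termination_by n
decreasing_by all_goals omega

/-- The square of the Euclidean norm. Euclidean norms are compared through their squares. -/
def sqNorm {k : ℕ} (v : Vec k) : ℕ := ∑ i, (v i).natAbs ^ 2

/-! ### What the algorithm computes -/

/-- `X_{-n}`, `n ≥ 1`, is a `k`-bonacci vector that is closest to `v` in the Euclidean norm. -/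
def IsClosest {k : ℕ} (v : Vec k) (n : ℕ) : Prop :=
  1 ≤ n ∧ ∀ m, 1 ≤ m → sqNorm (v - bonacciVec k n) ≤ sqNorm (v - bonacciVec k m)

/-- `|v_m|` for the maximally negative entry `v_m` of `v`, and `0` if no entry is negative. -/
def negMax {k : ℕ} (v : Vec k) : ℕ := Finset.univ.sup fun i => (-(v i)).toNat

/-- The small steps decomposition: `|v_m|` steps `X_{-k} = (-1, …, -1)`, and then `v_i - v_m` steps
`X_{-i} = e_i` for `1 ≤ i ≤ k-1`, where `v_m` is the maximally negative entry (read `v_m = 0` if no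
entry is negative). The result is the list of the indices `n` of the steps `X_{-n}`. -/
def smallSteps {k : ℕ} (v : Vec k) : List ℕ :=
  List.replicate (negMax v) k ++
    (List.finRange (k - 1)).flatMap fun i =>
      List.replicate (v i + negMax v).toNat ((i : ℕ) + 1)

/-- `LargeStepsRun v ns`: the list `ns = [n_1, …, n_N]` is the decomposition `v = ∑ X_{-n_i}` that a
run of the large steps procedure gives. In each round a closest `X_{-n}` is taken; if subtracting it
makes the Euclidean norm strictly smaller, the procedure goes on with the difference, and otherwise
it stops and decomposes the current vector by small steps. Closest vectors need not be unique, so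
that `v` may have several runs. -/
inductive LargeStepsRun {k : ℕ} : Vec k → List ℕ → Prop
  | step (v : Vec k) (n : ℕ) (ns : List ℕ) (hn : IsClosest v n)
      (hlt : sqNorm (v - bonacciVec k n) < sqNorm v)
      (hrun : LargeStepsRun (v - bonacciVec k n) ns) : LargeStepsRun v (n :: ns)
  | final (v : Vec k) (n : ℕ) (hn : IsClosest v n)
      (hle : sqNorm v ≤ sqNorm (v - bonacciVec k n)) : LargeStepsRun v (smallSteps v)

/-- `k (N - 1) + max n_i` for a decomposition `ns = [n_1, …, n_N]`. -/
def indexBound (k : ℕ) (ns : List ℕ) : ℕ := k * (ns.length - 1) + ns.foldr max 0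

/-- `S_{j+1}(v) = v · (x_j, …, x_{j+1-(k-1)}) mod x_{j+1}` (truncated indices as above). -/
def proj (k j : ℕ) (v : Vec k) : ℤ :=
  (∑ i : Fin (k - 1), v i * bonacciNum k (j - i)) % bonacciNum k (j + 1)

/-- `c = [c_1, …, c_j]` is an output of the vector Zeckendorf greedy algorithm with index `j`, which
stands for `∑ c_i X_{-i}`: no `k` consecutive `c_i` are `1`, and `∑ c_i x_{j+1-i} = S_{j+1}(v)`. -/
def IsVectorGreedyOutput (k j : ℕ) (v : Vec k) (c : List Bool) : Prop :=
  c.length = j ∧ ¬ List.replicate k true <:+: c ∧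
    ∑ i ∈ Finset.range j, (if c.getD i false then bonacciNum k (j - i) else 0) = proj k j v

/-! ### Computations with a count of the elementary operations -/

/-- A result together with the number of elementary operations that were used to compute it. -/
structure Timed (α : Type) where
  val : α
  cost : ℕ

instance : Monad Timed where
  pure a := ⟨a, 0⟩
  bind x f := ⟨(f x.val).val, x.cost + (f x.val).cost⟩

/-- Spend `c` elementary operations. -/
def tick (c : ℕ) : Timed Unit := ⟨(), c⟩

/-- One elementary operation (an addition, subtraction, multiplication or maximum of two integers)
with result `a`. -/
def op {α : Type} (a : α) : Timed α := ⟨a, 1⟩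

/-- A vector subtraction: one subtraction for each coordinate. -/
def subT {k : ℕ} (v w : Vec k) : Timed (Vec k) := ⟨v - w, k - 1⟩

/-- A squared Euclidean norm: one multiplication and one addition for each coordinate. -/
def sqNormT {k : ℕ} (v : Vec k) : Timed ℕ := ⟨sqNorm v, 2 * (k - 1)⟩

/-- Writing a list of `c` copies of `a`: one operation for each copy and one for the end. -/
def replicateT (c a : ℕ) : Timed (List ℕ) := ⟨List.replicate c a, c + 1⟩

/-! ### The table of the `k`-bonacci vectors -/

/-- A table lists pairs `(n, X_{-n})`, largest `n` first. The table `n = k-1, …, 1, 0`, written with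
`k` operations for each entry. -/
def initTable (k : ℕ) : Timed (List (ℕ × Vec k)) :=
  ⟨(List.range k).reverse.map fun n =>
    (n, if h : 1 ≤ n ∧ n < k then Pi.single (⟨n - 1, by omega⟩ : Fin (k - 1)) 1 else 0), k * k⟩

/-- Extend the table by one entry: the `k`-th entry from the top minus the `k-1` entries above it.
`k + 2` operations are spent on walking to the `k`-th entry, on the new index and on storing. -/
def nextEntry (k : ℕ) (T : List (ℕ × Vec k)) : Timed (List (ℕ × Vec k)) := do
  let X ← (T.take (k - 1)).foldlM (fun acc e => subT acc e.2) (T.getD (k - 1) (0, 0)).2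
  tick (k + 2)
  pure (((T.headD (0, 0)).1 + 1, X) :: T)

/-- Extend the table by `m` entries. -/
def extendTable (k : ℕ) : ℕ → List (ℕ × Vec k) → Timed (List (ℕ × Vec k))
  | 0, T => pure T
  | m + 1, T => do
    let T' ← nextEntry k T
    extendTable k m T'

/-- Extend the table by `A` entries for each of `p, 2p, 4p, …` that is at most `b`, and by a last `A`
entries. (The test `0 < p` only serves termination; the procedure is started with `p = 1`.) -/
def growTable (k A b p : ℕ) (T : List (ℕ × Vec k)) : Timed (List (ℕ × Vec k)) := do
  tick 1
  if _h : 0 < p ∧ p ≤ b then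
    let T' ← extendTable k A T
    tick 1
    growTable k A b (2 * p) T'
  else extendTable k A T
termination_by b + 1 - p
decreasing_by omega

/-- Keep the entries with `n ≥ 1` and squared norm at most `b`. -/
def filterTable {k : ℕ} (b : ℕ) : List (ℕ × Vec k) → Timed (List (ℕ × Vec k))
  | [] => pure []
  | e :: T => do
    let T' ← filterTable b T
    let s ← sqNormT e.2
    tick 3
    if 1 ≤ e.1 ∧ s ≤ b then pure (e :: T') else pure T'

/-- The `k`-bonacci vectors `X_{-n}` with `n ≥ 1` and `‖X_{-n}‖₂ ≤ 2 ‖v‖₂`, given `nv = ‖v‖₂²`. The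
number `A` is a constant of the program; it has to be large enough for the given `k`. -/
def candidates (k A nv : ℕ) : Timed (List (ℕ × Vec k)) := do
  let T₀ ← initTable k
  let T ← growTable k A nv 1 T₀
  let b ← op (4 * nv)
  filterTable b T

/-! ### The large steps algorithm -/

/-- Scan a list of pairs `(n, X_{-n})` for one that is closest to `v`; `best` is the best pair so
far and `db` its squared distance. `tie v n m` tells whether `n` shall replace `m` if both are
equally close to `v`. -/
def closest {k : ℕ} (tie : Vec k → ℕ → ℕ → Bool) (v : Vec k) (best : ℕ × Vec k) (db : ℕ) :
    List (ℕ × Vec k) → Timed (ℕ × Vec k)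
  | [] => pure best
  | e :: T => do
    let u ← subT v e.2
    let d ← sqNormT u
    tick 3
    if d < db ∨ (d = db ∧ tie v e.1 best.1 = true) then closest tie v e d T
    else closest tie v best db T

/-- The rounds of the large steps procedure, with candidates `e₀ :: T`, current vector `v` and
`nv = ‖v‖₂²`. The result is the list of the indices of the steps and the vector that is left. -/
def largeSteps {k : ℕ} (tie : Vec k → ℕ → ℕ → Bool) (e₀ : ℕ × Vec k) (T : List (ℕ × Vec k))
    (v : Vec k) (nv : ℕ) : Timed (List ℕ × Vec k) := do
  let u ← subT v e₀.2
  let d ← sqNormT u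
  let e ← closest tie v e₀ d T
  let w ← subT v e.2
  let nw ← sqNormT w
  tick 1
  if h : nw < nv then
    let r ← largeSteps tie e₀ T w nw
    tick 1
    pure (e.1 :: r.1, r.2)
  else pure ([], v)
termination_by nv

/-- The small steps procedure, which computes `smallSteps v`. -/
def smallStepsT {k : ℕ} (v : Vec k) : Timed (List ℕ) := do
  let m ← (List.finRange (k - 1)).foldlM (fun (a : ℕ) i => do
    tick 1
    op (max a (-(v i)).toNat)) 0
  let first ← replicateT m k
  (List.finRange (k - 1)).foldlM (fun (l : List ℕ) i => do
    let c ← op (v i + m).toNat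
    let r ← replicateT c ((i : ℕ) + 1)
    tick (l.length + 1)
    pure (l ++ r)) first

/-- Compute `k (N - 1) + max n_i`: one pass through the list, and three operations. -/
def indexBoundT (k : ℕ) (ns : List ℕ) : Timed ℕ := do
  let r ← ns.foldlM (fun (r : ℕ × ℕ) n => do
    let N ← op (r.1 + 1)
    let m ← op (max r.2 n)
    pure (N, m)) (0, 0)
  tick 3
  pure (k * (r.1 - 1) + r.2)

/-- The computation of `j_lsb`: a decomposition of `v` by large steps, and `j_lsb`. -/
def computeLsb (k A : ℕ) (tie : Vec k → ℕ → ℕ → Bool) (v : Vec k) : Timed (List ℕ × ℕ) := do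
  let nv ← sqNormT v
  let cs ← candidates k A nv
  let r ← match cs with
    | [] => pure ([], v)
    | e₀ :: T => largeSteps tie e₀ T v nv
  let s ← smallStepsT r.2
  tick (r.1.length + 1)
  let ns := r.1 ++ s
  let j ← indexBoundT k ns
  pure (ns, j)

/-! ### The vector Zeckendorf greedy algorithm -/

/-- Extend a list `[x_n, …, x_0]` of the `k`-bonacci numbers by `m` further ones. -/
def extendNums (k : ℕ) : ℕ → List ℤ → Timed (List ℤ)
  | 0, L => pure L
  | m + 1, L => do
    let x ← (L.take k).foldlM (fun a y => op (a + y)) 0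
    tick 1
    extendNums k m (x :: L)

/-- The scalar product of two lists. -/
def dotT (l l' : List ℤ) : Timed ℤ :=
  (l.zip l').foldlM (fun a p => do
    let q ← op (p.1 * p.2)
    op (a + q)) 0

/-- Subtract `m` until the result is less than `m`. (The test `0 < m` only serves termination.) -/
def subLoop (m a : ℤ) : Timed ℤ := do
  tick 1
  if _h : 0 < m ∧ m ≤ a then
    tick 1
    subLoop m (a - m)
  else pure a
termination_by a.toNat
decreasing_by omega

/-- Add `m` until the result is nonnegative. (The test `0 < m` only serves termination.) -/
def addLoop (m a : ℤ) : Timed ℤ := do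
  tick 1
  if _h : 0 < m ∧ a < 0 then
    tick 1
    addLoop m (a + m)
  else pure a
termination_by (-a).toNat
decreasing_by omega

/-- `a` modulo `m` by repeated additions and subtractions. -/
def modT (m a : ℤ) : Timed ℤ := do
  let b ← addLoop m a
  subLoop m b

/-- The greedy algorithm: go down the list of numbers, and subtract each one that is at most the
current remainder. The result tells which numbers were used. -/
def greedy : List ℤ → ℤ → Timed (List Bool)
  | [], _ => pure []
  | x :: L, r => do
    tick 1
    if x ≤ r then
      let r' ← op (r - x)
      let c ← greedy L r'
      tick 1
      pure (true :: c)
    else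
      let c ← greedy L r
      tick 1
      pure (false :: c)

/-- The vector Zeckendorf greedy algorithm with index `j`: compute `[x_{j+1}, x_j, …, x_0]`, apply
`S_{j+1}`, and run the greedy algorithm with `x_j, …, x_1`. -/
def vectorGreedy (k j : ℕ) (v : Vec k) : Timed (List Bool) := do
  tick 2
  let L ← extendNums k j [1, 0]
  tick (k + j)
  let s ← dotT (List.ofFn v) L.tail
  let r ← modT (L.headD 0) s
  greedy (L.tail.take j) r

/-- The large steps algorithm: compute `j_lsb`, then run the vector Zeckendorf greedy algorithm with
`j = j_lsb`. -/
def largeStepsAlgorithm (k A : ℕ) (tie : Vec k → ℕ → ℕ → Bool) (v : Vec k) :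
    Timed (List Bool) := do
  let r ← computeLsb k A tie v
  vectorGreedy k r.2 v

end LargeSteps

namespace LargeSteps

open Finset

/-! ### Real sequences with the reversed `k`-bonacci recurrence -/

/-! Everything rests on ‖v - X_{-n}‖² = ‖v‖² - 2 v·X_{-n} + ‖X_{-n}‖²: a round shortens `v` well if
some X_{-n} of moderate length has a large positive product with `v`. The products v·X_{-n} form a
sequence with a_0 = 0 and a_n = a_{n+1} + ⋯ + a_{n+k}. The only decaying mode of this recurrence is
y^n, with y in (0,1) and y + ⋯ + y^k = 1. Passing to b_n = a_{n+1} - y a_n removes it. Each b_n is a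
weighted mean of the k following terms, and every window of b straddles 0. Read backwards, b
therefore contracts geometrically; read forwards, a grows exponentially (`exists_growth`). Since a_0
= 0, large terms of positive sign also occur (`exists_le_of_neg`).

For general k, taking n of order log ‖v‖ gives a drop of ‖v‖² by at least c‖v‖ log ‖v‖²
(`exists_shortening`). Hence there are O(‖v‖ / log ‖v‖) rounds. Each round scans a table of O(log
‖v‖) vectors, because ‖X_{-n}‖ grows exponentially: some root of the recurrence lies outside the
unit circle (`exists_complex_root`). The product is O(‖v‖). The small steps, and the reduction
modulo x_{j+1} in the greedy part, are linear in ‖v‖ as well.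

For k ≤ 3 all modes of b have the same modulus, so that v·X_{-n} and ‖X_{-n}‖ grow at one common
rate ρ^n. Choosing ρ^n comparable to ‖v‖ shortens `v` by a constant factor
(`exists_shortening_factor`), so there are O(log ‖v‖) rounds and the remaining vector is bounded.
Where j_lsb is logarithmic, the bound on the number N of steps is immediate from k(N-1) ≤ j_lsb.

The program agrees with the procedure because a step that does not lengthen `v` satisfies ‖X_{-n}‖ ≤
2‖v‖, and norms only decrease, so one table serves all rounds. -/

/-- The sequence `a_n` starts with `a_0 = 0` and satisfies `a_n = a_{n+1} + ⋯ + a_{n+k}`. -/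
def IsBackward (k : ℕ) (a : ℕ → ℝ) : Prop :=
  a 0 = 0 ∧ ∀ n, a n = ∑ i ∈ range k, a (n + 1 + i)

/-- `y` is the inverse of the dominant root of the `k`-bonacci polynomial. -/
def IsInvRoot (k : ℕ) (y : ℝ) : Prop :=
  0 < y ∧ y < 1 ∧ ∑ i ∈ range k, y ^ (i + 1) = 1

theorem exists_isInvRoot {k : ℕ} (hk : 2 ≤ k) : ∃ y, IsInvRoot k y := by
  have hcont : ContinuousOn (fun y : ℝ => ∑ i ∈ range k, y ^ (i + 1)) (Set.Icc 0 1) := by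
    fun_prop
  have h := intermediate_value_Ioo (zero_le_one) hcont
  have h1 : (1 : ℝ) ∈ Set.Ioo (∑ i ∈ range k, (0 : ℝ) ^ (i + 1))
      (∑ i ∈ range k, (1 : ℝ) ^ (i + 1)) := by
    have : (2 : ℝ) ≤ k := by exact_mod_cast hk
    simp
    linarith
  obtain ⟨y, hy, hy1⟩ := h h1
  exact ⟨y, hy.1, hy.2, hy1⟩

namespace IsBackward

variable {k : ℕ} {a : ℕ → ℝ}

/-- A window of k negative terms makes the term before it negative too, so negativity would spread
back to a_0 = 0. -/
theorem not_forall_neg (hk : 2 ≤ k) (ha : IsBackward k a) (n : ℕ) :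
    ¬ ∀ i < k, a (n + i) < 0 := by
  induction n with
  | zero =>
    intro h
    have := h 0 (by omega)
    simp [ha.1] at this
  | succ n ih =>
    intro h
    apply ih
    intro i hi
    rcases Nat.eq_zero_or_pos i with rfl | hpos
    · rw [add_zero, ha.2 n]
      exact sum_neg (fun j hj => h j (mem_range.mp hj)) ⟨0, mem_range.mpr (by omega)⟩
    · have := h (i - 1) (by omega)
      rwa [show n + 1 + (i - 1) = n + i by omega] at this

/-- A large negative term forces a comparable positive term nearby. -/
theorem exists_le_of_neg (hk : 2 ≤ k) (ha : IsBackward k a) (n : ℕ) :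
    ∃ l, n + 1 ≤ l ∧ l ≤ n + 2 * k ∧ |a (n + k)| ≤ k * a l := by
  have hk' : (2 : ℝ) ≤ k := by exact_mod_cast hk
  by_contra! hcon
  by_cases h0 : 0 ≤ a (n + k)
  · have := hcon (n + k) (by omega) (by omega)
    rw [abs_of_nonneg h0] at this
    nlinarith
  push Not at h0
  rw [abs_of_neg h0] at hcon
  -- Each a_{n+i} with i < k is a sum of k terms, one of which is a_{n+k}. The other k - 1 are below
  -- |a_{n+k}| / k and cannot compensate it, so the whole window at n would be negative.
  refine ha.not_forall_neg hk n fun i hi => ?_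
  rw [ha.2 (n + i)]
  have hmem : k - 1 - i ∈ range k := mem_range.mpr (by omega)
  rw [← add_sum_erase _ _ hmem, show n + i + 1 + (k - 1 - i) = n + k by omega]
  have hle : ∑ x ∈ (range k).erase (k - 1 - i), a (n + i + 1 + x)
      ≤ ∑ x ∈ (range k).erase (k - 1 - i), (-a (n + k)) / k := by
    refine sum_le_sum fun x hx => ?_
    have hx' := mem_range.mp (mem_of_mem_erase hx)
    have := hcon (n + i + 1 + x) (by omega) (by omega)
    rw [le_div_iff₀ (by linarith)]
    linarith
  rw [sum_const, card_erase_of_mem hmem, card_range, nsmul_eq_mul, Nat.cast_sub (by omega)] at hle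
  have : ((k : ℝ) - (1 : ℕ)) * (-a (n + k) / k) < -a (n + k) := by
    rw [mul_div_assoc', div_lt_iff₀ (by linarith)]
    push_cast
    nlinarith
  linarith

/-- Solving the recurrence for its last term expresses it by k earlier ones, which costs at most a
factor k per index. -/
theorem abs_le_pow (hk : 2 ≤ k) (ha : IsBackward k a) {B : ℝ} (hB : ∀ i < k, |a i| ≤ B) (n : ℕ) :
    |a n| ≤ k ^ n * B := by
  have hk' : (1 : ℝ) ≤ k := by exact_mod_cast (by omega : 1 ≤ k)
  have hB0 : 0 ≤ B := (abs_nonneg _).trans (hB 0 (by omega))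
  induction n using Nat.strong_induction_on with
  | _ n ih =>
    by_cases hn : n < k
    · exact (hB n hn).trans (le_mul_of_one_le_left hB0 (one_le_pow₀ hk'))
    · obtain ⟨m, rfl⟩ : ∃ m, n = m + k := ⟨n - k, by omega⟩
      obtain ⟨l, rfl⟩ : ∃ l, k = l + 1 := ⟨k - 1, by omega⟩
      have h := ha.2 m
      rw [sum_range_succ] at h
      have h2 : a (m + (l + 1)) = a m - ∑ i ∈ range l, a (m + 1 + i) := by
        rw [h, show m + (l + 1) = m + 1 + l by omega]; ring
      rw [h2]
      have hterm : ∀ j, j ≤ l → |a (m + j)| ≤ ((l + 1 : ℕ) : ℝ) ^ (m + l) * B := fun j hj =>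
        (ih (m + j) (by omega)).trans (mul_le_mul_of_nonneg_right
          (pow_le_pow_right₀ hk' (by omega)) hB0)
      calc |a m - ∑ i ∈ range l, a (m + 1 + i)|
          ≤ |a m| + ∑ i ∈ range l, |a (m + 1 + i)| :=
            (abs_sub _ _).trans (add_le_add_right (abs_sum_le_sum_abs _ _) _)
        _ ≤ ((l + 1 : ℕ) : ℝ) ^ (m + l) * B
            + ∑ i ∈ range l, ((l + 1 : ℕ) : ℝ) ^ (m + l) * B := by
            refine add_le_add (hterm 0 (by omega)) (sum_le_sum fun i hi => ?_)
            have := mem_range.mp hi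
            rw [add_assoc]
            exact hterm (1 + i) (by omega)
        _ = ((l + 1 : ℕ) : ℝ) ^ (m + (l + 1)) * B := by
            rw [sum_const, card_range, nsmul_eq_mul, ← add_assoc m l 1, pow_succ]
            push_cast
            ring

/-- Subtract two consecutive instances of the recurrence; on the characteristic polynomial this is
multiplication by x - 1. -/
theorem sum_shift (ha : IsBackward k a) (n : ℕ) :
    a (n + k + 1) = 2 * a (n + 1) - a n := by
  have h1 := ha.2 n
  have h2 := ha.2 (n + 1)
  have h3 := sum_range_succ (fun i => a (n + 1 + i)) k
  rw [sum_range_succ'] at h3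
  simp only [add_zero, ← add_assoc] at h3
  have h4 : ∑ i ∈ range k, a (n + 1 + 1 + i) = ∑ i ∈ range k, a (n + 1 + i + 1) :=
    sum_congr rfl fun i _ => by congr 1; omega
  rw [show n + k + 1 = n + 1 + k by omega]
  linarith

/-! ### Removing the decaying mode: contraction and exponential growth -/

/-- The part of a backward sequence on the non-dominant roots. -/
def contract (y : ℝ) (a : ℕ → ℝ) (n : ℕ) : ℝ := a (n + 1) - y * a n

variable {y : ℝ}

theorem _root_.LargeSteps.IsInvRoot.pow_succ_eq (hy : IsInvRoot k y) :
    y ^ (k + 1) = 2 * y - 1 := by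
  have h := hy.2.2
  have h1 : ∑ i ∈ range k, y ^ (i + 1) = y * ∑ i ∈ range k, y ^ i := by
    rw [mul_sum]; exact sum_congr rfl fun i _ => by ring
  have h2 := mul_geom_sum y k
  rw [h1] at h
  have : y * ((y - 1) * ∑ i ∈ range k, y ^ i) = y * (y ^ k - 1) := by rw [h2]
  have h3 : (y - 1) * (y * ∑ i ∈ range k, y ^ i) = y - 1 := by rw [h]; ring
  rw [pow_succ]
  linarith

/-- The contracted sequence is a weighted mean of the `k` following terms. -/
theorem contract_eq_sum (hy : IsInvRoot k y) (ha : IsBackward k a) (n : ℕ) :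
    contract y a n = ∑ i ∈ range k, y ^ (k - i) * contract y a (n + 1 + i) := by
  -- The weighted sum telescopes to y a_{n+k+1} - y^{k+1} a_{n+1}; then a_{n+k+1} = 2a_{n+1} - a_n
  -- and y^{k+1} = 2y - 1 are inserted.
  have htel : ∀ i ∈ range k, y ^ (k - i) * contract y a (n + 1 + i)
      = y ^ (k + 1 - (i + 1)) * a (n + 1 + (i + 1)) - y ^ (k + 1 - i) * a (n + 1 + i) := by
    intro i hi
    have := mem_range.mp hi
    rw [contract, show k + 1 - i = k - i + 1 by omega, show k + 1 - (i + 1) = k - i by omega,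
      pow_succ, add_assoc (n + 1) i 1]
    ring
  rw [sum_congr rfl htel, sum_range_sub (fun i => y ^ (k + 1 - i) * a (n + 1 + i))]
  rw [show k + 1 - k = 1 by omega, Nat.sub_zero, hy.pow_succ_eq, add_zero,
    show n + 1 + k = n + k + 1 by omega, ha.sum_shift, contract]
  ring

theorem weight_sum (hy : IsInvRoot k y) : ∑ i ∈ range k, y ^ (k - i) = 1 := by
  rw [← hy.2.2, ← sum_range_reflect]
  refine sum_congr rfl fun i hi => ?_
  have := mem_range.mp hi
  congr 1
  omega

/-- Summation by parts, truncated at m so that induction applies. The geometric sums are the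
coefficients left after dividing the characteristic polynomial by the factor of the root y. -/
theorem sum_geom_mul_contract (n m : ℕ) (hm : m < k) :
    ∑ j ∈ range (m + 1), (∑ i ∈ range (k - j), y ^ i) * contract y a (n + j)
      = ∑ i ∈ range m, a (n + 1 + i) + (∑ i ∈ range (k - m), y ^ i) * a (n + m + 1)
        - y * (∑ i ∈ range k, y ^ i) * a n := by
  induction m with
  | zero => simp [contract]; ring
  | succ m ih =>
    rw [sum_range_succ, ih (by omega), sum_range_succ _ m, contract,
      show k - m = k - (m + 1) + 1 by omega, sum_range_succ' _ (k - (m + 1)), pow_zero,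
      show n + 1 + m = n + m + 1 by omega, show n + (m + 1) = n + m + 1 by omega]
    simp_rw [pow_succ, ← sum_mul]
    ring

/-- The contracted sequence satisfies a recurrence of order k - 1 with positive coefficients. This
excludes nonzero constants, which the weighted mean property alone would allow. -/
theorem sum_geom_mul_contract_eq_zero (hk : 2 ≤ k) (hy : IsInvRoot k y) (ha : IsBackward k a)
    (n : ℕ) :
    ∑ j ∈ range k, (∑ i ∈ range (k - j), y ^ i) * contract y a (n + j) = 0 := by
  have h := sum_geom_mul_contract (k := k) (y := y) (a := a) n (k - 1) (by omega)
  have h1 : y * ∑ i ∈ range k, y ^ i = 1 := by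
    rw [← hy.2.2, mul_sum]; exact sum_congr rfl fun i _ => by ring
  rw [show k - 1 + 1 = k by omega, h1, show k - (k - 1) = 1 by omega] at h
  rw [h, ha.2 n]
  have := sum_range_succ (fun i => a (n + 1 + i)) (k - 1)
  rw [show k - 1 + 1 = k by omega] at this
  rw [this, show n + 1 + (k - 1) = n + (k - 1) + 1 by omega]
  simp

/-- Windows of the contracted sequence straddle `0`. -/
theorem abs_contract_le_of_mem_Icc (hk : 2 ≤ k) (hy : IsInvRoot k y) (ha : IsBackward k a) {n : ℕ}
    {lo hi : ℝ} (h : ∀ i < k, contract y a (n + i) ∈ Set.Icc lo hi) {i : ℕ} (hi' : i < k) :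
    |contract y a (n + i)| ≤ hi - lo := by
  have hQ : ∀ j ∈ range k, 0 < ∑ i ∈ range (k - j), y ^ i := fun j hj =>
    sum_pos (fun i _ => pow_pos hy.1 i) ⟨0, by have := mem_range.mp hj; simp; omega⟩
  have h0 := ha.sum_geom_mul_contract_eq_zero hk hy n
  -- A vanishing combination with positive coefficients has terms of both signs or only zeros, so
  -- the interval contains 0 and its length bounds every term.
  have hlo : lo ≤ 0 := by
    by_contra! hlo
    have : 0 < ∑ j ∈ range k, (∑ i ∈ range (k - j), y ^ i) * contract y a (n + j) :=
      sum_pos (fun j hj => mul_pos (hQ j hj) (hlo.trans_le (h j (mem_range.mp hj)).1))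
        ⟨0, by simp; omega⟩
    linarith
  have hhi : 0 ≤ hi := by
    by_contra! hhi
    have : ∑ j ∈ range k, (∑ i ∈ range (k - j), y ^ i) * contract y a (n + j) < 0 :=
      sum_neg (fun j hj => mul_neg_of_pos_of_neg (hQ j hj)
        ((h j (mem_range.mp hj)).2.trans_lt hhi)) ⟨0, by simp; omega⟩
    linarith
  have := h i hi'
  rw [abs_le]
  constructor <;> linarith [this.1, this.2]

/-- One pass over a window makes the oscillation smaller by the factor `1 - y ^ k`. -/
theorem exists_Icc_of_Icc (hk : 2 ≤ k) (hy : IsInvRoot k y) (ha : IsBackward k a) {n : ℕ}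
    {lo hi : ℝ} (h : ∀ i < k, contract y a (n + k + i) ∈ Set.Icc lo hi) :
    ∃ lo' hi', hi' - lo' = (1 - y ^ k) * (hi - lo) ∧
      ∀ i < k, contract y a (n + i) ∈ Set.Icc lo' hi' := by
  -- Weighted means stay in the interval, so it survives when the window slides back one place at a
  -- time.
  have hall : ∀ j ≤ k, ∀ i < k, contract y a (n + (k - j) + i) ∈ Set.Icc lo hi := by
    intro j
    induction j with
    | zero => intro _ i hi'; simpa using h i hi'
    | succ j ih =>
      intro hj i hi'
      have ih := ih (by omega)
      rcases Nat.eq_zero_or_pos i with rfl | hpos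
      · rw [add_zero, ha.contract_eq_sum hy]
        refine (convex_Icc lo hi).sum_mem (fun i _ => (pow_pos hy.1 _).le) (weight_sum hy)
          fun i hi'' => ?_
        have := ih i (mem_range.mp hi'')
        rwa [show n + (k - j) + i = n + (k - (j + 1)) + 1 + i by omega] at this
      · have := ih (i - 1) (by omega)
        rwa [show n + (k - j) + (i - 1) = n + (k - (j + 1)) + i by omega] at this
  set x := contract y a (n + k) with hx
  have hxI : x ∈ Set.Icc lo hi := by simpa using h 0 (by omega)
  -- The single term x = b_{n+k} enters the mean of every term of the preceding window with weight
  -- at least y^k. Both ends of the interval therefore move towards x by that proportion.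
  refine ⟨lo + y ^ k * (x - lo), hi - y ^ k * (hi - x), by ring, fun i hi' => ?_⟩
  have hmem : k - 1 - i ∈ range k := mem_range.mpr (by omega)
  have hw : y ^ k ≤ y ^ (k - (k - 1 - i)) := pow_le_pow_of_le_one hy.1.le hy.2.1.le (by omega)
  have hb : ∀ j ∈ range k, contract y a (n + i + 1 + j) ∈ Set.Icc lo hi := by
    intro j hj
    have hj := mem_range.mp hj
    rcases le_or_gt k (i + 1 + j) with h' | h'
    · have := h (i + 1 + j - k) (by omega)
      rwa [show n + k + (i + 1 + j - k) = n + i + 1 + j by omega] at this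
    · have := hall k le_rfl (i + 1 + j) h'
      rwa [show n + (k - k) + (i + 1 + j) = n + i + 1 + j by omega] at this
  have hsum := weight_sum hy
  have heq := ha.contract_eq_sum hy (n + i)
  have hxx : contract y a (n + i + 1 + (k - 1 - i)) = x := by
    rw [hx]; congr 1; omega
  have e1 : contract y a (n + i) - lo
      = ∑ j ∈ range k, y ^ (k - j) * (contract y a (n + i + 1 + j) - lo) := by
    simp_rw [mul_sub, sum_sub_distrib, ← sum_mul, hsum, ← heq, one_mul]
  have e2 : hi - contract y a (n + i)
      = ∑ j ∈ range k, y ^ (k - j) * (hi - contract y a (n + i + 1 + j)) := by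
    simp_rw [mul_sub, sum_sub_distrib, ← sum_mul, hsum, ← heq, one_mul]
  have l1 := single_le_sum (f := fun j => y ^ (k - j) * (contract y a (n + i + 1 + j) - lo))
    (fun j hj => mul_nonneg (pow_pos hy.1 _).le (sub_nonneg.mpr (hb j hj).1)) hmem
  have l2 := single_le_sum (f := fun j => y ^ (k - j) * (hi - contract y a (n + i + 1 + j)))
    (fun j hj => mul_nonneg (pow_pos hy.1 _).le (sub_nonneg.mpr (hb j hj).2)) hmem
  simp only [hxx] at l1 l2
  have m1 := mul_le_mul_of_nonneg_right hw (sub_nonneg.mpr hxI.1)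
  have m2 := mul_le_mul_of_nonneg_right hw (sub_nonneg.mpr hxI.2)
  constructor <;> linarith

theorem abs_contract_le_of_window (hk : 2 ≤ k) (hy : IsInvRoot k y) (ha : IsBackward k a) (m : ℕ)
    {lo hi : ℝ} (h : ∀ i < k, contract y a (m * k + i) ∈ Set.Icc lo hi) {i : ℕ} (hi' : i < k) :
    |contract y a i| ≤ (1 - y ^ k) ^ m * (hi - lo) := by
  induction m generalizing lo hi with
  | zero =>
    have := ha.abs_contract_le_of_mem_Icc hk hy h hi'
    simpa using this
  | succ m ih =>
    obtain ⟨lo', hi', h1, h2⟩ := ha.exists_Icc_of_Icc hk hy (n := m * k) (lo := lo) (hi := hi)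
      (fun i hi => by have := h i hi; rwa [add_mul, one_mul] at this)
    refine (ih h2).trans_eq ?_
    rw [h1]
    ring

theorem abs_le_of_abs_contract_le (hy : IsInvRoot k y) (ha : IsBackward k a) {B : ℝ}
    (h : ∀ i < k, |contract y a i| ≤ B) (i : ℕ) (hi : i ≤ k) : |a i| ≤ i * B := by
  induction i with
  | zero => simp [ha.1]
  | succ i ih =>
    have h1 := ih (by omega)
    have h2 := h i (by omega)
    have : a (i + 1) = contract y a i + y * a i := by rw [contract]; ring
    rw [this]
    have h3 : |y * a i| ≤ |a i| := by
      rw [abs_mul, abs_of_pos hy.1]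
      exact mul_le_of_le_one_left (abs_nonneg _) hy.2.1.le
    have := abs_add_le (contract y a i) (y * a i)
    push_cast
    linarith

/-- Exponential growth in windows of length `k + 1`. -/
theorem exists_growth (hk : 2 ≤ k) (hy : IsInvRoot k y) (ha : IsBackward k a) {B : ℝ}
    (hB : ∃ i < k, B ≤ |a i|) (m : ℕ) :
    ∃ n, m * k ≤ n ∧ n ≤ m * k + k ∧ B ≤ 4 * k * (1 - y ^ k) ^ m * |a n| := by
  have hk' : (2 : ℝ) ≤ k := by exact_mod_cast hk
  have hθ : 0 < 1 - y ^ k := sub_pos.mpr (pow_lt_one₀ hy.1.le hy.2.1 (by omega))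
  have hθm : 0 < (1 - y ^ k) ^ m := pow_pos hθ m
  by_contra! hcon
  have hcoef : 0 < 4 * k * (1 - y ^ k) ^ m := by positivity
  -- If |a_n| < D throughout the window, then b lies in [-2D, 2D], of length 4D. After m
  -- contractions, summing fewer than k terms of b gives |a_i| < 4k(1 - y^k)^m D = B.
  set D := B / (4 * k * (1 - y ^ k) ^ m) with hD
  have hD' : ∀ n, m * k ≤ n → n ≤ m * k + k → |a n| < D := fun n h1 h2 => by
    rw [hD, lt_div_iff₀ hcoef]
    linarith [hcon n h1 h2]
  have hb : ∀ i < k, contract y a (m * k + i) ∈ Set.Icc (-(2 * D)) (2 * D) := by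
    intro i hi
    rw [Set.mem_Icc, ← abs_le, contract]
    have h1 := hD' (m * k + i) (by omega) (by omega)
    have h2 := hD' (m * k + i + 1) (by omega) (by omega)
    have h3 : |y * a (m * k + i)| ≤ |a (m * k + i)| := by
      rw [abs_mul, abs_of_pos hy.1]
      exact mul_le_of_le_one_left (abs_nonneg _) hy.2.1.le
    have := abs_sub (a (m * k + i + 1)) (y * a (m * k + i))
    linarith
  have hfin := fun i (hi : i < k) => ha.abs_contract_le_of_window hk hy m hb hi
  obtain ⟨i, hi, hBi⟩ := hB
  have h1 := ha.abs_le_of_abs_contract_le hy hfin i hi.le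
  have hDpos : 0 < D := (abs_nonneg _).trans_lt (hD' (m * k) le_rfl (by omega))
  have h2 : B = 4 * k * (1 - y ^ k) ^ m * D := by rw [hD]; field_simp
  have hik : (i : ℝ) < k := by exact_mod_cast hi
  have h3 : (i : ℝ) * ((1 - y ^ k) ^ m * (2 * D - -(2 * D)))
      < k * ((1 - y ^ k) ^ m * (2 * D - -(2 * D))) :=
    mul_lt_mul_of_pos_right hik (mul_pos hθm (by linarith))
  linarith

/-- There are positive terms of exponential size in every long window. -/
theorem exists_pos_growth (hk : 2 ≤ k) (hy : IsInvRoot k y) (ha : IsBackward k a) {B : ℝ}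
    (hB : ∃ i < k, B ≤ |a i|) (m : ℕ) :
    ∃ n, 1 ≤ n ∧ n ≤ (m + 4) * k ∧ B ≤ 4 * k ^ 2 * (1 - y ^ k) ^ m * a n := by
  have hθ : 0 < 1 - y ^ k := sub_pos.mpr (pow_lt_one₀ hy.1.le hy.2.1 (by omega))
  -- With m + 1 in place of m the index is at least k, as needed to write it as n' + k.
  obtain ⟨n, h1, h2, h3⟩ := ha.exists_growth hk hy hB (m + 1)
  obtain ⟨n, rfl⟩ : ∃ n', n = n' + k := ⟨n - k, by rw [add_mul] at h1; omega⟩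
  obtain ⟨l, l1, l2, l3⟩ := ha.exists_le_of_neg hk n
  refine ⟨l, by omega, by rw [add_mul] at h2 ⊢; omega, h3.trans ?_⟩
  have h0 : 0 ≤ |a (n + k)| := abs_nonneg _
  have : (1 - y ^ k) ^ (m + 1) ≤ (1 - y ^ k) ^ m :=
    pow_le_pow_of_le_one hθ.le (by linarith [pow_pos hy.1 k]) (by omega)
  calc 4 * k * (1 - y ^ k) ^ (m + 1) * |a (n + k)| ≤ 4 * k * (1 - y ^ k) ^ m * |a (n + k)| := by
        gcongr
    _ ≤ 4 * k * (1 - y ^ k) ^ m * (k * a l) := by gcongr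
    _ = _ := by ring

end IsBackward

/-! ### Exact growth rates for k = 2 and k = 3 -/

/-- The contracted sequences grow exactly like `ρ ^ n`, up to the constants `c` and `C`. -/
def HasExactGrowth (k : ℕ) (y ρ c C : ℝ) : Prop :=
  ∀ a, IsBackward k a →
    (∀ B, 0 < B → (∃ i < k, B ≤ |a i|) → ∀ n,
      c * ρ ^ n * B ≤ |IsBackward.contract y a n| ∨
      c * ρ ^ n * B ≤ |IsBackward.contract y a (n + 1)|) ∧
    (∀ B, (∀ i < k, |a i| ≤ B) → ∀ n, |IsBackward.contract y a n| ≤ C * ρ ^ n * B)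

/-- The contracted recurrence has order one: b_{n+1} = -(1 + y) b_n, and 1 + y = y⁻¹. -/
theorem hasExactGrowth_two {y : ℝ} (hy : IsInvRoot 2 y) : HasExactGrowth 2 y y⁻¹ 1 1 := by
  have hy2 : y + y ^ 2 = 1 := by simpa [sum_range_succ] using hy.2.2
  have hy0 := hy.1
  intro a ha
  have hstep : ∀ n, IsBackward.contract y a (n + 1) = -y⁻¹ * IsBackward.contract y a n := by
    intro n
    have h := ha.sum_geom_mul_contract_eq_zero le_rfl hy n
    simp [sum_range_succ] at h
    have hinv : y⁻¹ = 1 + y := (eq_inv_of_mul_eq_one_left (by nlinarith)).symm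
    rw [hinv]
    linarith
  have habs : ∀ n, |IsBackward.contract y a n| = y⁻¹ ^ n * |a 1| := by
    intro n
    induction n with
    | zero => simp [IsBackward.contract, ha.1]
    | succ n ih =>
      rw [hstep, abs_mul, ih, abs_neg, abs_of_pos (inv_pos.mpr hy0), pow_succ]
      ring
  have hpos : ∀ n : ℕ, 0 < y⁻¹ ^ n := fun n => pow_pos (inv_pos.mpr hy0) n
  constructor
  · rintro B hB ⟨i, hi, hBi⟩ n
    left
    rw [habs, one_mul]
    refine mul_le_mul_of_nonneg_left ?_ (hpos n).le
    interval_cases i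
    · rw [ha.1, abs_zero] at hBi; linarith
    · exact hBi
  · intro B hB n
    rw [habs, one_mul]
    exact mul_le_mul_of_nonneg_left (hB 1 (by norm_num)) (hpos n).le

/-- The contracted recurrence has order two, and its roots are conjugate with product y⁻¹, hence of
modulus y^{-1/2}. The growth is read off from a positive definite quadratic form that is multiplied
by y⁻¹ in each step. -/
theorem exists_hasExactGrowth_three {y : ℝ} (hy : IsInvRoot 3 y) :
    ∃ c C : ℝ, 0 < c ∧ 0 < C ∧ HasExactGrowth 3 y (√y)⁻¹ c C := by
  have hy3 : y + y ^ 2 + y ^ 3 = 1 := by simpa [sum_range_succ] using hy.2.2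
  obtain ⟨hy0, hy1, -⟩ := hy
  set ρ := (√y)⁻¹ with hρ
  have hρ0 : 0 < ρ := inv_pos.mpr (Real.sqrt_pos.mpr hy0)
  have hρ2 : ρ ^ 2 = y⁻¹ := by rw [hρ, inv_pow, Real.sq_sqrt hy0.le]
  have hinv : y⁻¹ = 1 + y + y ^ 2 :=
    (eq_inv_of_mul_eq_one_left (by nlinarith)).symm
  have hyinv : 1 < y⁻¹ := (one_lt_inv₀ hy0).mpr hy1
  -- The quotient of the constants 2y⁻¹ and (1 - y)/2 that compare the form `E` with b_n² + b_{n+1}²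
  -- from above and below.
  set κ := 4 * y⁻¹ / (1 - y) with hκ
  have h1y : 0 < 1 - y := by linarith
  have hκ0 : 0 < κ := by positivity
  set K := √κ with hK
  have hK0 : 0 < K := Real.sqrt_pos.mpr hκ0
  have hK2 : K ^ 2 = κ := Real.sq_sqrt hκ0.le
  refine ⟨(2 * K)⁻¹, 3 * K, by positivity, by positivity, fun a ha => ?_⟩
  set b := IsBackward.contract y a with hb
  have hstep : ∀ n, b (n + 2) = -(1 + y) * b (n + 1) - y⁻¹ * b n := by
    intro n
    have h := ha.sum_geom_mul_contract_eq_zero (by norm_num) ⟨hy0, hy1, by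
      simpa [sum_range_succ] using hy3⟩ n
    simp [sum_range_succ] at h
    rw [hinv]
    linarith
  set E : ℕ → ℝ := fun n => b (n + 1) ^ 2 + (1 + y) * b (n + 1) * b n + y⁻¹ * b n ^ 2 with hE
  have hEn : ∀ n, E n = (ρ ^ n) ^ 2 * E 0 := by
    intro n
    induction n with
    | zero => simp
    | succ n ih =>
      have : E (n + 1) = y⁻¹ * E n := by
        simp only [hE]
        rw [hstep]
        ring
      rw [this, ih, ← hρ2]
      ring
  have hlow : ∀ n, (1 - y) / 2 * (b n ^ 2 + b (n + 1) ^ 2) ≤ E n := by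
    intro n
    simp only [hE]
    nlinarith [mul_nonneg (by linarith : 0 ≤ 1 + y) (sq_nonneg (b n + b (n + 1))),
      mul_nonneg (by linarith : 0 ≤ y⁻¹ - 1) (sq_nonneg (b n))]
  have hupp : ∀ n, E n ≤ 2 * y⁻¹ * (b n ^ 2 + b (n + 1) ^ 2) := by
    intro n
    simp only [hE]
    nlinarith [mul_nonneg (by linarith : 0 ≤ 1 + y) (sq_nonneg (b n - b (n + 1))),
      mul_nonneg (by linarith : 0 ≤ y⁻¹ - 1) (sq_nonneg (b n)),
      mul_nonneg (by linarith : 0 ≤ y⁻¹ - 1) (sq_nonneg (b (n + 1)))]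
  have hκmul : κ * ((1 - y) / 2) = 2 * y⁻¹ := by rw [hκ]; field_simp; norm_num
  have hcmp : ∀ n, b n ^ 2 + b (n + 1) ^ 2 ≤ κ * (ρ ^ n) ^ 2 * (b 0 ^ 2 + b 1 ^ 2) := by
    intro n
    have h1 := hlow n
    have h2 := mul_le_mul_of_nonneg_left (hupp 0) (sq_nonneg (ρ ^ n))
    rw [hEn] at h1
    rw [← hκmul] at h2
    have h3 := h1.trans h2
    rw [zero_add] at h3
    have h4 : (1 - y) / 2 * (b n ^ 2 + b (n + 1) ^ 2)
        ≤ (1 - y) / 2 * (κ * (ρ ^ n) ^ 2 * (b 0 ^ 2 + b 1 ^ 2)) := by linarith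
    exact le_of_mul_le_mul_left h4 (by linarith)
  have hcmp' : ∀ n, (ρ ^ n) ^ 2 * (b 0 ^ 2 + b 1 ^ 2) ≤ κ * (b n ^ 2 + b (n + 1) ^ 2) := by
    intro n
    have h1 := hupp n
    have h2 := mul_le_mul_of_nonneg_left (hlow 0) (sq_nonneg (ρ ^ n))
    rw [hEn] at h1
    rw [← hκmul] at h1
    have h3 := h2.trans h1
    rw [zero_add] at h3
    have h4 : (1 - y) / 2 * ((ρ ^ n) ^ 2 * (b 0 ^ 2 + b 1 ^ 2))
        ≤ (1 - y) / 2 * (κ * (b n ^ 2 + b (n + 1) ^ 2)) := by linarith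
    exact le_of_mul_le_mul_left h4 (by linarith)
  have hb0 : b 0 = a 1 := by simp [hb, IsBackward.contract, ha.1]
  have hb1 : b 1 = a 2 - y * a 1 := by simp [hb, IsBackward.contract]
  constructor
  · rintro B hB ⟨i, hi, hBi⟩ n
    have hB2 : B ^ 2 ≤ 2 * (b 0 ^ 2 + b 1 ^ 2) := by
      have hsq : B ^ 2 ≤ a i ^ 2 := by
        rw [← sq_abs (a i)]
        exact pow_le_pow_left₀ hB.le hBi 2
      interval_cases i
      · rw [ha.1, abs_zero] at hBi; linarith
      · rw [hb0]; nlinarith [sq_nonneg (b 1)]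
      · have ha2 : a 2 = b 1 + y * b 0 := by rw [hb1, hb0]; ring
        rw [ha2] at hsq
        nlinarith [sq_nonneg (b 1 - y * b 0), mul_nonneg (sq_nonneg (b 0))
          (by nlinarith : 0 ≤ 1 - y ^ 2)]
    by_contra! hcon
    obtain ⟨c1, c2⟩ := hcon
    have hnn : 0 ≤ (2 * K)⁻¹ * ρ ^ n * B := by positivity
    have s1 := pow_lt_pow_left₀ c1 (abs_nonneg _) two_ne_zero
    have s2 := pow_lt_pow_left₀ c2 (abs_nonneg _) two_ne_zero
    rw [sq_abs] at s1 s2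
    have h1 := hcmp' n
    -- Two such squares times κ give (ρ^n)² B² / 2, which is at most (ρ^n)² (b_0² + b_1²) by `hB2`:
    -- the choice (2K)⁻¹ just yields the contradiction.
    have hval : κ * ((2 * K)⁻¹ * ρ ^ n * B) ^ 2 = (ρ ^ n) ^ 2 * B ^ 2 / 4 := by
      rw [← hK2]; field_simp; norm_num
    have h2 := mul_lt_mul_of_pos_left (add_lt_add s1 s2) hκ0
    have h3 := mul_le_mul_of_nonneg_left hB2 (sq_nonneg (ρ ^ n))
    linarith
  · intro B hB n
    have hB0 : 0 ≤ B := (abs_nonneg _).trans (hB 0 (by norm_num))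
    have e1 := hB 1 (by norm_num)
    have e2 := hB 2 (by norm_num)
    refine abs_le_of_sq_le_sq ?_ (by positivity)
    have f1 : b 0 ^ 2 ≤ B ^ 2 := by
      rw [hb0]; exact sq_le_sq' (by linarith [abs_le.mp e1]) (abs_le.mp e1).2
    have f2 : b 1 ^ 2 ≤ (2 * B) ^ 2 := by
      have h3 : |y * a 1| ≤ |a 1| := by
        rw [abs_mul, abs_of_pos hy0]
        exact mul_le_of_le_one_left (abs_nonneg _) hy1.le
      have := abs_sub (a 2) (y * a 1)
      rw [hb1, ← sq_abs]
      exact pow_le_pow_left₀ (abs_nonneg _) (by linarith) 2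
    have h1 := hcmp n
    have h2 : κ * (ρ ^ n) ^ 2 * (b 0 ^ 2 + b 1 ^ 2) ≤ κ * (ρ ^ n) ^ 2 * (5 * B ^ 2) := by
      gcongr
      linarith
    have h3 : (3 * K * ρ ^ n * B) ^ 2 = 9 * (κ * (ρ ^ n) ^ 2 * B ^ 2) := by rw [← hK2]; ring
    have h4 : 0 ≤ κ * (ρ ^ n) ^ 2 * B ^ 2 := by positivity
    rw [h3]
    nlinarith [sq_nonneg (b (n + 1))]

/-- For `k ≤ 3`, backward sequences have an exact rate of growth. -/
theorem exists_exact_growth {k : ℕ} (hk : 2 ≤ k) (hk3 : k ≤ 3) :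
    ∃ ρ c C : ℝ, 1 < ρ ∧ 0 < c ∧ 0 < C ∧ ∀ a, IsBackward k a →
      (∀ B, 0 < B → (∃ i < k, B ≤ |a i|) → ∀ m, ∃ n, 1 ≤ n ∧ n ≤ m + 10 ∧ c * ρ ^ m * B ≤ a n) ∧
      (∀ B, (∀ i < k, |a i| ≤ B) → ∀ n, |a n| ≤ C * ρ ^ n * B) := by
  obtain ⟨y, hy⟩ := exists_isInvRoot hk
  obtain ⟨ρ, c, C, hρ, hc, hC, hG⟩ : ∃ ρ c C : ℝ, 1 < ρ ∧ 0 < c ∧ 0 < C ∧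
      HasExactGrowth k y ρ c C := by
    interval_cases k
    · exact ⟨y⁻¹, 1, 1, (one_lt_inv₀ hy.1).mpr hy.2.1, one_pos, one_pos, hasExactGrowth_two hy⟩
    · obtain ⟨c, C, hc, hC, h⟩ := exists_hasExactGrowth_three hy
      refine ⟨_, c, C, (one_lt_inv₀ (Real.sqrt_pos.mpr hy.1)).mpr ?_, hc, hC, h⟩
      rw [Real.sqrt_lt' one_pos]
      simpa using hy.2.1
  have hk0 : (0 : ℝ) < k := by exact_mod_cast (by omega : 0 < k)
  have hρy : 0 < ρ - y := by linarith [hy.2.1]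
  refine ⟨ρ, c / (2 * k), C / (ρ - y), hρ, by positivity, by positivity, fun a ha => ⟨?_, ?_⟩⟩
  · intro B hB hBi m
    have hrec : ∀ n, a (n + 1) = IsBackward.contract y a n + y * a n := fun n => by
      rw [IsBackward.contract]; ring
    have hstep : ∀ n, |IsBackward.contract y a n| ≤ 2 * |a n| ∨
        |IsBackward.contract y a n| ≤ 2 * |a (n + 1)| := by
      intro n
      by_contra! h
      have h3 : |y * a n| ≤ |a n| := by
        rw [abs_mul, abs_of_pos hy.1]
        exact mul_le_of_le_one_left (abs_nonneg _) hy.2.1.le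
      have := abs_sub (a (n + 1)) (y * a n)
      rw [IsBackward.contract] at h
      linarith [h.1, h.2]
    -- Starting at m + 3 ensures N ≥ 3 ≥ k, so that N = n + k and a positive term can be found near
    -- N.
    have hN : ∃ N, N ≤ m + 5 ∧ k ≤ N ∧ c * ρ ^ m * B ≤ 2 * |a N| := by
      have hmono : c * ρ ^ m * B ≤ c * ρ ^ (m + 3) * B := by
        gcongr
        · exact hρ.le
        · omega
      rcases ((hG a ha).1 B hB hBi (m + 3)) with h | h
      · rcases hstep (m + 3) with h' | h'
        · exact ⟨m + 3, by omega, by omega, by linarith⟩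
        · exact ⟨m + 3 + 1, by omega, by omega, by linarith⟩
      · rcases hstep (m + 3 + 1) with h' | h'
        · exact ⟨m + 3 + 1, by omega, by omega, by linarith⟩
        · exact ⟨m + 3 + 1 + 1, by omega, by omega, by linarith⟩
    obtain ⟨N, hN1, hN2, hN3⟩ := hN
    obtain ⟨n, rfl⟩ : ∃ n, N = n + k := ⟨N - k, by omega⟩
    obtain ⟨l, l1, l2, l3⟩ := ha.exists_le_of_neg hk n
    refine ⟨l, by omega, by omega, ?_⟩
    have : c / (2 * k) * ρ ^ m * B = c * ρ ^ m * B / (2 * k) := by ring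
    rw [this, div_le_iff₀ (by positivity)]
    linarith
  · intro B hB n
    have hB0 : 0 ≤ B := (abs_nonneg _).trans (hB 0 (by omega))
    have hup := (hG a ha).2 B hB
    -- The constant C/(ρ - y) is preserved by a_{n+1} = b_n + y a_n, because C + y · C/(ρ - y) = ρ ·
    -- C/(ρ - y).
    induction n with
    | zero => rw [ha.1, abs_zero]; positivity
    | succ n ih =>
      have h1 : a (n + 1) = IsBackward.contract y a n + y * a n := by
        rw [IsBackward.contract]; ring
      have h2 : |y * a n| = y * |a n| := by rw [abs_mul, abs_of_pos hy.1]
      have h3 := abs_add_le (IsBackward.contract y a n) (y * a n)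
      have h4 := mul_le_mul_of_nonneg_left ih hy.1.le
      rw [h1]
      refine h3.trans ?_
      rw [h2]
      refine (add_le_add (hup n) h4).trans_eq ?_
      rw [pow_succ]
      field_simp
      ring

/-! ### The `k`-bonacci vectors -/

variable {k : ℕ}

theorem bonacciVec_zero : bonacciVec k 0 = 0 := by
  rw [bonacciVec]; simp

theorem bonacciVec_of_lt {n : ℕ} (h0 : 0 < n) (hn : n < k) :
    bonacciVec k n = Pi.single (⟨n - 1, by omega⟩ : Fin (k - 1)) 1 := by
  rw [bonacciVec, dif_neg (by omega), dif_pos hn]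

theorem bonacciVec_of_le (hk : 2 ≤ k) {n : ℕ} (hn : k ≤ n) :
    bonacciVec k n
      = bonacciVec k (n - k) - ∑ i ∈ range (k - 1), bonacciVec k (n - 1 - i) := by
  rw [bonacciVec, dif_neg (by omega), dif_neg (by omega)]

theorem bonacciVec_eq_sum (hk : 2 ≤ k) (n : ℕ) :
    bonacciVec k n = ∑ i ∈ range k, bonacciVec k (n + 1 + i) := by
  obtain ⟨l, rfl⟩ : ∃ l, k = l + 1 := ⟨k - 1, by omega⟩
  have h : bonacciVec (l + 1) (n + (l + 1)) = bonacciVec (l + 1) (n + (l + 1) - (l + 1))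
      - ∑ i ∈ range l, bonacciVec (l + 1) (n + (l + 1) - 1 - i) := bonacciVec_of_le hk (by omega)
  rw [sum_range_succ, show n + 1 + l = n + (l + 1) by omega, h,
    show n + (l + 1) - (l + 1) = n by omega, ← sum_range_reflect]
  have : ∑ j ∈ range l, bonacciVec (l + 1) (n + 1 + (l - 1 - j))
      = ∑ i ∈ range l, bonacciVec (l + 1) (n + (l + 1) - 1 - i) := by
    refine sum_congr rfl fun i hi => ?_
    have := mem_range.mp hi
    congr 1
    omega
  rw [this]
  abel

/-- The inner product with the `k`-bonacci vectors. -/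
def pairing {k : ℕ} (v : Vec k) (n : ℕ) : ℝ := ∑ i, (v i : ℝ) * (bonacciVec k n i : ℝ)

theorem isBackward_pairing (hk : 2 ≤ k) (v : Vec k) : IsBackward k (pairing v) := by
  constructor
  · simp [pairing, bonacciVec_zero]
  · intro n
    simp only [pairing]
    rw [sum_comm]
    refine sum_congr rfl fun i _ => ?_
    rw [← mul_sum]
    congr 1
    rw [bonacciVec_eq_sum hk n]
    simp

theorem isBackward_coord (hk : 2 ≤ k) (i : Fin (k - 1)) :
    IsBackward k fun n => (bonacciVec k n i : ℝ) := by
  constructor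
  · simp [bonacciVec_zero]
  · intro n
    change (bonacciVec k n i : ℝ) = ∑ j ∈ range k, (bonacciVec k (n + 1 + j) i : ℝ)
    rw [bonacciVec_eq_sum hk n]
    simp

theorem pairing_succ (v : Vec k) (i : Fin (k - 1)) : pairing v (i + 1) = v i := by
  have hi := i.2
  rw [pairing, bonacciVec_of_lt (by omega) (by omega)]
  rw [sum_eq_single i]
  · simp
  · intro j _ hj
    rw [Pi.single_eq_of_ne]
    · simp
    · intro h
      apply hj
      rw [h]
      simp
  · simp

theorem abs_coord_le (n : ℕ) (hn : n < k) (i : Fin (k - 1)) :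
    |(bonacciVec k n i : ℝ)| ≤ 1 := by
  rcases Nat.eq_zero_or_pos n with rfl | h0
  · simp [bonacciVec_zero]
  · rw [bonacciVec_of_lt h0 hn, Pi.single_apply]
    split <;> simp

theorem cast_sqNorm (v : Vec k) : (sqNorm v : ℝ) = ∑ i, (v i : ℝ) ^ 2 := by
  simp only [sqNorm, Nat.cast_sum, Nat.cast_pow, Nat.cast_natAbs, Int.cast_abs, sq_abs]

theorem cast_sqNorm_sub (v : Vec k) (n : ℕ) :
    (sqNorm (v - bonacciVec k n) : ℝ)
      = sqNorm v - 2 * pairing v n + sqNorm (bonacciVec k n) := by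
  simp only [cast_sqNorm, pairing, mul_sum, ← sum_sub_distrib, ← sum_add_distrib]
  refine sum_congr rfl fun i _ => ?_
  simp
  ring

theorem sqNorm_le_of_abs_le {v : Vec k} {B : ℝ} (h : ∀ i, |(v i : ℝ)| ≤ B) :
    (sqNorm v : ℝ) ≤ k * B ^ 2 := by
  rw [cast_sqNorm]
  have hle : ∀ i ∈ (univ : Finset (Fin (k - 1))), (v i : ℝ) ^ 2 ≤ B ^ 2 := fun i _ => by
    rw [← sq_abs]
    exact pow_le_pow_left₀ (abs_nonneg _) (h i) 2
  refine (sum_le_sum hle).trans ?_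
  rw [sum_const, card_univ, Fintype.card_fin, nsmul_eq_mul]
  gcongr
  omega

theorem abs_le_sqrt_sqNorm (v : Vec k) (i : Fin (k - 1)) : |(v i : ℝ)| ≤ √(sqNorm v) := by
  rw [cast_sqNorm]
  refine Real.abs_le_sqrt ?_
  exact single_le_sum (f := fun i => (v i : ℝ) ^ 2) (fun _ _ => sq_nonneg _) (mem_univ i)

theorem exists_coord_large (hk : 2 ≤ k) (v : Vec k) :
    ∃ i : Fin (k - 1), √(sqNorm v) ≤ k * |(v i : ℝ)| := by
  have hk' : (2 : ℝ) ≤ k := by exact_mod_cast hk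
  obtain ⟨i, -, hi⟩ := exists_max_image (univ : Finset (Fin (k - 1))) (fun i => |(v i : ℝ)|)
    ⟨⟨0, by omega⟩, mem_univ _⟩
  refine ⟨i, ?_⟩
  rw [Real.sqrt_le_left (by positivity), mul_pow]
  refine (sqNorm_le_of_abs_le fun j => hi j (mem_univ j)).trans ?_
  gcongr
  nlinarith

/-- The products with X_0, …, X_{-(k-1)} are 0 and the coordinates of `v`, so the largest coordinate
serves. -/
theorem exists_pairing_large (hk : 2 ≤ k) (v : Vec k) :
    ∃ i < k, √(sqNorm v) / k ≤ |pairing v i| := by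
  obtain ⟨i, hi⟩ := exists_coord_large hk v
  have hi2 := i.2
  have hk' : (0 : ℝ) < k := by exact_mod_cast (by omega : 0 < k)
  refine ⟨i + 1, by omega, ?_⟩
  rw [pairing_succ, div_le_iff₀ hk']
  linarith

/-! ### How much one step can shorten a vector -/

/-- Vectors that are large can be shortened substantially, for every `k`. -/
theorem exists_shortening (hk : 2 ≤ k) :
    ∃ c : ℝ, ∃ R : ℕ, 0 < c ∧ ∀ v : Vec k, R ≤ sqNorm v → ∃ n, 1 ≤ n ∧
      (sqNorm (v - bonacciVec k n) : ℝ)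
        ≤ sqNorm v - c * √(sqNorm v) * Real.log (sqNorm v) := by
  obtain ⟨y, hy⟩ := exists_isInvRoot hk
  have hk' : (2 : ℝ) ≤ k := by exact_mod_cast hk
  have hyk : 0 < y ^ k := pow_pos hy.1 k
  have hθ : 0 < 1 - y ^ k := sub_pos.mpr (pow_lt_one₀ hy.1.le hy.2.1 (by omega))
  -- For n ≤ (m + 4)k the crude bound k^n on the coordinates gives ‖X_{-n}‖² ≤ k P^{m+4}, which is
  -- the later C P^m.
  set P : ℝ := (k : ℝ) ^ (2 * k) with hP
  have hP1 : 1 < P := one_lt_pow₀ (by linarith) (by omega)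
  set lP := Real.log P with hlP
  have hlP0 : 0 < lP := Real.log_pos hP1
  set δ := y ^ k with hδ
  set c := δ / (4 * k ^ 3 * (8 * lP)) with hc
  have hc0 : 0 < c := by positivity
  set C := k * P ^ 4 with hC
  have hC0 : 0 < C := by positivity
  -- The three summands serve, in turn, to lose at most half in the floor defining `m`, to have C/c
  -- ≤ exp(L/4), and to have L ≥ 1.
  obtain ⟨R, hR⟩ := exists_nat_gt (Real.exp (8 * lP + 4 * (C / c) + 1))
  refine ⟨c, R, hc0, fun v hv => ?_⟩
  set s : ℝ := ((sqNorm v : ℕ) : ℝ) with hs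
  have hsR : Real.exp (8 * lP + 4 * (C / c) + 1) < s := hR.trans_le (Nat.cast_le.mpr hv)
  have hs0 : 0 < s := (Real.exp_pos _).trans hsR
  set L := Real.log s with hL
  have hLlarge : 8 * lP + 4 * (C / c) + 1 < L := (Real.lt_log_iff_exp_lt hs0).mpr hsR
  have hCc : 0 < C / c := by positivity
  have hL0 : 0 < L := by linarith
  have hsqrt : √s = Real.exp (L / 2) := by
    rw [Real.sqrt_eq_rpow, Real.rpow_def_of_pos hs0]
    congr 1
    ring
  -- Chosen so that P^m ≤ s^{1/4}: then ‖X_{-n}‖² is at most c √s log s, while m is still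
  -- proportional to log s.
  set m := ⌊L / (4 * lP)⌋₊ with hm
  have hm1 : (m : ℝ) ≤ L / (4 * lP) := Nat.floor_le (by positivity)
  have hm2 : L / (8 * lP) ≤ m := by
    have := Nat.lt_floor_add_one (L / (4 * lP))
    have h1 : 1 ≤ L / (8 * lP) := by rw [le_div_iff₀ (by positivity)]; linarith
    have h2 : L / (4 * lP) = 2 * (L / (8 * lP)) := by field_simp; norm_num
    rw [← hm] at this
    linarith
  have hPm : P ^ m ≤ Real.exp (L / 4) := by
    rw [← Real.rpow_natCast, Real.rpow_def_of_pos (by linarith), ← hlP]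
    apply Real.exp_le_exp.mpr
    rw [le_div_iff₀ (by positivity)] at hm1
    linarith
  obtain ⟨n, hn1, hn2, hn3⟩ :=
    (isBackward_pairing hk v).exists_pos_growth hk hy (exists_pairing_large hk v) m
  refine ⟨n, hn1, ?_⟩
  rw [cast_sqNorm_sub, ← hs]
  have hnorm : (sqNorm (bonacciVec k n) : ℝ) ≤ C * P ^ m := by
    have h1 : ∀ i, |(bonacciVec k n i : ℝ)| ≤ (k : ℝ) ^ ((m + 4) * k) := fun i => by
      have := (isBackward_coord hk i).abs_le_pow hk (B := 1) (fun j hj => abs_coord_le j hj i) n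
      rw [mul_one] at this
      exact this.trans (pow_le_pow_right₀ (by linarith) hn2)
    refine (sqNorm_le_of_abs_le h1).trans_eq ?_
    rw [hC, mul_assoc, ← pow_add, ← pow_mul, hP, ← pow_mul]
    congr 2
    ring
  -- Bernoulli keeps only a linear part of the exponential growth; this supplies the factor log s,
  -- and no more is needed.
  have hbern : 1 + m * δ ≤ (1 - δ)⁻¹ ^ m := by
    have hinv : 1 + δ ≤ (1 - δ)⁻¹ := by
      rw [le_inv_comm₀ (by positivity) hθ]
      rw [← one_div, le_div_iff₀ (by positivity)]
      nlinarith
    refine (one_add_mul_le_pow (by linarith) m).trans ?_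
    gcongr
  have hpair : 2 * c * √s * L ≤ 2 * pairing v n := by
    have h1 : √s / k * (1 - δ)⁻¹ ^ m ≤ 4 * k ^ 2 * pairing v n := by
      rw [inv_pow, ← div_eq_mul_inv, div_le_iff₀ (pow_pos hθ m)]
      linarith
    have h2 : √s / k * (L / (8 * lP) * δ) ≤ √s / k * (1 - δ)⁻¹ ^ m := by
      refine mul_le_mul_of_nonneg_left ?_ (by positivity)
      refine le_trans ?_ hbern
      have := mul_le_mul_of_nonneg_right hm2 hyk.le
      linarith
    have h3 : c * √s * L = √s / k * (L / (8 * lP) * δ) / (4 * k ^ 2) := by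
      rw [hc]; field_simp
    have h4 : c * √s * L ≤ pairing v n := by
      rw [h3, div_le_iff₀ (by positivity)]
      linarith
    linarith
  have hsmall : C * P ^ m ≤ c * √s * L := by
    have h1 : C * P ^ m ≤ C * Real.exp (L / 4) := by gcongr
    have h2 : C / c ≤ Real.exp (L / 4) := by
      have := Real.add_one_le_exp (L / 4)
      linarith
    rw [div_le_iff₀ hc0] at h2
    have h3 : √s = Real.exp (L / 4) * Real.exp (L / 4) := by
      rw [hsqrt, ← Real.exp_add]; congr 1; ring
    have h4 : C * Real.exp (L / 4) ≤ Real.exp (L / 4) * c * Real.exp (L / 4) := by gcongr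
    have h5 : 0 ≤ c * √s := by positivity
    have h6 : c * √s * 1 ≤ c * √s * L := mul_le_mul_of_nonneg_left (by linarith) h5
    rw [h3] at h6 ⊢
    linarith
  linarith

/-- For `k ≤ 3`, vectors that are large can be shortened by a constant factor. -/
theorem exists_shortening_factor (hk : 2 ≤ k) (hk3 : k ≤ 3) :
    ∃ ε : ℝ, ∃ R : ℕ, 0 < ε ∧ ε < 1 ∧ ∀ v : Vec k, R ≤ sqNorm v → ∃ n, 1 ≤ n ∧
      (sqNorm (v - bonacciVec k n) : ℝ) ≤ (1 - ε) * sqNorm v := by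
  obtain ⟨ρ, c, C, hρ, hc, hC, h⟩ := exists_exact_growth hk hk3
  have hk' : (2 : ℝ) ≤ k := by exact_mod_cast hk
  set c' := c / k with hc'
  have hc'0 : 0 < c' := by positivity
  set D := k * (C * ρ ^ 10) ^ 2 with hD
  have hρ0 : 0 < ρ := by linarith
  have hD0 : 0 < D := by positivity
  -- With ρ^m ≤ η√s the quadratic term D(ρ^m)² is at most c'ρ^m√s, that is, half of the gain 2
  -- v·X_{-n} that is guaranteed.
  set η := c' / D with hη
  have hη0 : 0 < η := by positivity
  obtain ⟨R, hR⟩ := exists_nat_gt ((η⁻¹) ^ 2)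
  refine ⟨min (c' * η / ρ) (1 / 2), R, lt_min (by positivity) (by norm_num),
    (min_le_right _ _).trans_lt (by norm_num), fun v hv => ?_⟩
  set s : ℝ := ((sqNorm v : ℕ) : ℝ) with hs
  have hsR : η⁻¹ ^ 2 < s := hR.trans_le (Nat.cast_le.mpr hv)
  have hs0 : 0 < s := lt_of_le_of_lt (by positivity) hsR
  have hsqrt : η⁻¹ ≤ √s := Real.le_sqrt_of_sq_le hsR.le
  have hsq0 : 0 < √s := Real.sqrt_pos.mpr hs0
  have hη1 : 1 ≤ η * √s := by
    rwa [inv_le_iff_one_le_mul₀' hη0] at hsqrt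
  -- The power ρ^m is the last one not above η√s, so it is also larger than η√s/ρ; this makes the
  -- drop proportional to s.
  obtain ⟨m, hm1, hm2⟩ := exists_nat_pow_near hη1 hρ
  obtain ⟨n, hn1, hn2, hn3⟩ := (h _ (isBackward_pairing hk v)).1 (√s / k) (by positivity)
    (exists_pairing_large hk v) m
  refine ⟨n, hn1, ?_⟩
  rw [cast_sqNorm_sub, ← hs]
  have hnorm : (sqNorm (bonacciVec k n) : ℝ) ≤ D * (ρ ^ m) ^ 2 := by
    have h1 : ∀ i, |(bonacciVec k n i : ℝ)| ≤ C * ρ ^ (m + 10) := fun i => by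
      have := (h _ (isBackward_coord hk i)).2 1 (fun j hj => abs_coord_le j hj i) n
      rw [mul_one] at this
      refine this.trans ?_
      gcongr
      exact hρ.le
    refine (sqNorm_le_of_abs_le h1).trans_eq ?_
    rw [hD, pow_add]
    ring
  have hpair : c' * ρ ^ m * √s ≤ pairing v n := by
    refine le_trans (le_of_eq ?_) hn3
    rw [hc']; ring
  have hDm : D * (ρ ^ m) ^ 2 ≤ c' * ρ ^ m * √s := by
    have h1 : D * ρ ^ m * ρ ^ m ≤ D * ρ ^ m * (η * √s) :=
      mul_le_mul_of_nonneg_left hm1 (by positivity)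
    have h2 : D * ρ ^ m * (η * √s) = c' * ρ ^ m * √s := by rw [hη]; field_simp
    nlinarith
  have hfin : c' * η / ρ * s ≤ c' * ρ ^ m * √s := by
    have h1 : η * √s / ρ ≤ ρ ^ m := by
      rw [div_le_iff₀ hρ0, ← pow_succ]; exact hm2.le
    have h2 : c' * √s * (η * √s / ρ) ≤ c' * √s * ρ ^ m := by gcongr
    have h3 : c' * √s * (η * √s / ρ) = c' * η / ρ * s := by
      rw [← Real.mul_self_sqrt hs0.le]
      simp only [Real.sqrt_mul_self hsq0.le]
      ring
    linarith
  have hmin : min (c' * η / ρ) (1 / 2) * s ≤ c' * η / ρ * s :=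
    mul_le_mul_of_nonneg_right (min_le_left _ _) hs0.le
  linarith

/-! ### Exponential growth of the `k`-bonacci vectors -/

/-- The polynomial is monic with constant coefficient -1, so its roots have moduli with product 1.
As y lies inside the unit circle, some root lies outside. -/
theorem exists_complex_root (hk : 2 ≤ k) :
    ∃ z : ℂ, 1 < ‖z‖ ∧ ∑ i ∈ range k, z ^ (i + 1) = 1 := by
  obtain ⟨y, hy⟩ := exists_isInvRoot hk
  obtain ⟨l, rfl⟩ : ∃ l, k = l + 1 := ⟨k - 1, by omega⟩
  set p : Polynomial ℂ := ∑ i ∈ range (l + 1), Polynomial.X ^ (i + 1) - 1 with hp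
  have hroot : ∀ z : ℂ, p.eval z = 0 ↔ ∑ i ∈ range (l + 1), z ^ (i + 1) = 1 := fun z => by
    simp [hp, Polynomial.eval_finsetSum, sub_eq_zero]
  set q : Polynomial ℂ := ∑ i ∈ range l, Polynomial.X ^ (i + 1) - 1 with hq
  have hpq : p = Polynomial.X ^ (l + 1) + q := by
    rw [hp, sum_range_succ, hq]; ring
  have hqdeg : q.degree < ((l + 1 : ℕ) : WithBot ℕ) := by
    refine (Polynomial.degree_sub_le _ _).trans_lt (max_lt ?_ ?_)
    · refine (Polynomial.degree_sum_le _ _).trans_lt ?_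
      rw [Finset.sup_lt_iff (by exact WithBot.bot_lt_coe _)]
      intro i hi
      have := mem_range.mp hi
      rw [Polynomial.degree_X_pow]
      exact_mod_cast (by omega : i + 1 < l + 1)
    · rw [Polynomial.degree_one]
      exact_mod_cast (by omega : 0 < l + 1)
  have hmonic : p.Monic := by rw [hpq]; exact Polynomial.monic_X_pow_add hqdeg
  have hp0 : p ≠ 0 := hmonic.ne_zero
  have hcoeff : p.coeff 0 = -1 := by
    rw [Polynomial.coeff_zero_eq_eval_zero]
    simp [hp, Polynomial.eval_finsetSum]
  have hprod := (IsAlgClosed.splits p).coeff_zero_eq_prod_roots_of_monic hmonic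
  have hnorm : (p.roots.map fun z => ‖z‖).prod = 1 := by
    have := congrArg norm hprod
    rw [hcoeff, norm_mul, norm_pow, norm_neg, norm_one, one_pow, one_mul] at this
    rw [this]
    exact (map_multiset_prod (normHom : ℂ →*₀ ℝ) p.roots).symm
  have hymem : (y : ℂ) ∈ p.roots := by
    rw [Polynomial.mem_roots hp0, Polynomial.IsRoot, hroot]
    exact_mod_cast hy.2.2
  by_contra! hcon
  have hle : ∀ z ∈ p.roots, ‖z‖ ≤ 1 := fun z hz => by
    by_contra! hz1
    rw [Polynomial.mem_roots hp0, Polynomial.IsRoot, hroot] at hz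
    exact hcon z hz1 hz
  obtain ⟨t, ht⟩ := Multiset.exists_cons_of_mem hymem
  rw [ht, Multiset.map_cons, Multiset.prod_cons] at hnorm
  have h1 : (t.map fun z => ‖z‖).prod ≤ 1 := by
    have hgen : ∀ t : Multiset ℂ, (∀ z ∈ t, ‖z‖ ≤ 1) →
        0 ≤ (t.map fun z => ‖z‖).prod ∧ (t.map fun z => ‖z‖).prod ≤ 1 := by
      intro t
      induction t using Multiset.induction with
      | empty => simp
      | cons a t ih =>
        intro h
        obtain ⟨i1, i2⟩ := ih fun z hz => h z (Multiset.mem_cons_of_mem hz)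
        rw [Multiset.map_cons, Multiset.prod_cons]
        exact ⟨mul_nonneg (norm_nonneg _) i1,
          mul_le_one₀ (h a (Multiset.mem_cons_self a t)) i1 i2⟩
    exact (hgen t fun z hz => hle z (by rw [ht]; exact Multiset.mem_cons_of_mem hz)).2
  have h2 : ‖(y : ℂ)‖ = y := by rw [Complex.norm_real, Real.norm_eq_abs, abs_of_pos hy.1]
  rw [h2] at hnorm
  nlinarith [hy.1, hy.2.1]

/-- The sequence z^n - w^n satisfies the recurrence and vanishes at 0, so it is the combination of
the coordinate sequences fixed by its values at 1, …, k - 1. A single power would not vanish at 0,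
hence the difference. -/
theorem sum_mul_bonacciVec (hk : 2 ≤ k) {z w : ℂ} (hz : ∑ i ∈ range k, z ^ (i + 1) = 1)
    (hw : ∑ i ∈ range k, w ^ (i + 1) = 1) (n : ℕ) :
    ∑ i : Fin (k - 1), (bonacciVec k n i : ℂ) * (z ^ (i.val + 1) - w ^ (i.val + 1))
      = z ^ n - w ^ n := by
  induction n using Nat.strong_induction_on with
  | _ n ih =>
    by_cases hn : n < k
    · rcases Nat.eq_zero_or_pos n with rfl | h0
      · simp [bonacciVec_zero]
      · rw [bonacciVec_of_lt h0 hn, sum_eq_single (⟨n - 1, by omega⟩ : Fin (k - 1))]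
        · simp [Nat.sub_add_cancel h0]
        · intro j _ hj
          rw [Pi.single_eq_of_ne hj]
          simp
        · simp
    · obtain ⟨m, rfl⟩ : ∃ m, n = m + k := ⟨n - k, by omega⟩
      obtain ⟨l, rfl⟩ : ∃ l, k = l + 1 := ⟨k - 1, by omega⟩
      have h := bonacciVec_eq_sum hk m
      rw [sum_range_succ, show m + 1 + l = m + (l + 1) by omega] at h
      have h' := eq_sub_of_add_eq' h.symm
      have hpow : ∀ z : ℂ, ∑ i ∈ range (l + 1), z ^ (i + 1) = 1 →
          z ^ (m + (l + 1)) = z ^ m - ∑ j ∈ range l, z ^ (m + 1 + j) := by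
        intro z hz
        rw [sum_range_succ] at hz
        have : ∑ j ∈ range l, z ^ (m + 1 + j) = z ^ m * ∑ i ∈ range l, z ^ (i + 1) := by
          rw [mul_sum]; exact sum_congr rfl fun i _ => by ring
        rw [this, pow_add]
        linear_combination z ^ m * hz
      rw [h', hpow z hz, hpow w hw]
      simp only [Pi.sub_apply, Finset.sum_apply, Int.cast_sub, Int.cast_sum, sub_mul,
        sum_sub_distrib, sum_mul]
      rw [sum_comm, ih m (by omega),
        sum_congr rfl fun j hj => ih (m + 1 + j) (by have := mem_range.mp hj; omega)]
      rw [sum_sub_distrib]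
      ring

/-- A number of table rows that suffices for the search of closest vectors. -/
theorem exists_table_constant (hk : 2 ≤ k) :
    ∃ A : ℕ, ∀ b t n : ℕ, b < 2 ^ t → A * (t + 1) ≤ n → 4 * b < sqNorm (bonacciVec k n) := by
  obtain ⟨y, hy⟩ := exists_isInvRoot hk
  obtain ⟨z, hz1, hz⟩ := exists_complex_root hk
  have hw : ∑ i ∈ range k, (y : ℂ) ^ (i + 1) = 1 := by exact_mod_cast hy.2.2
  set K : ℝ := 1 + ∑ i : Fin (k - 1), ‖z ^ (i.val + 1) - (y : ℂ) ^ (i.val + 1)‖ with hK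
  have hK1 : 1 ≤ K := le_add_of_nonneg_right (sum_nonneg fun _ _ => norm_nonneg _)
  have hlow : ∀ n, ‖z‖ ^ n - 1 ≤ K * √(sqNorm (bonacciVec k n)) := by
    intro n
    have h1 : ‖z ^ n - (y : ℂ) ^ n‖ ≤ K * √(sqNorm (bonacciVec k n)) := by
      rw [← sum_mul_bonacciVec hk hz hw n]
      refine (norm_sum_le _ _).trans ?_
      have : ∀ i ∈ (univ : Finset (Fin (k - 1))),
          ‖(bonacciVec k n i : ℂ) * (z ^ (i.val + 1) - (y : ℂ) ^ (i.val + 1))‖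
            ≤ ‖z ^ (i.val + 1) - (y : ℂ) ^ (i.val + 1)‖ * √(sqNorm (bonacciVec k n)) := by
        intro i _
        rw [norm_mul, mul_comm, Complex.norm_intCast]
        exact mul_le_mul_of_nonneg_left (abs_le_sqrt_sqNorm _ i) (norm_nonneg _)
      refine (sum_le_sum this).trans ?_
      rw [← sum_mul]
      gcongr
      linarith
    have h2 := norm_sub_norm_le (z ^ n) ((y : ℂ) ^ n)
    rw [norm_pow, norm_pow, Complex.norm_real, Real.norm_eq_abs, abs_of_pos hy.1] at h2
    have h3 : y ^ n ≤ 1 := pow_le_one₀ hy.1.le hy.2.1.le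
    linarith
  -- Then ‖z‖^n ≥ (2K + 1)^{t+1} ≥ 2K · 2^t + 1 for n ≥ A(t + 1), so ‖X_{-n}‖ ≥ 2 · 2^t and its
  -- square exceeds 4b.
  obtain ⟨A, hA⟩ := pow_unbounded_of_one_lt (2 * K + 1) hz1
  refine ⟨A, fun b t n hb hn => ?_⟩
  have h1 : 2 * K * 2 ^ t ≤ ‖z‖ ^ n - 1 := by
    have h2 : ‖z‖ ^ (A * (t + 1)) ≤ ‖z‖ ^ n := pow_le_pow_right₀ hz1.le hn
    have h3 : (2 * K + 1) ^ (t + 1) ≤ ‖z‖ ^ (A * (t + 1)) := by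
      rw [pow_mul]; gcongr
    have h4 : (2 : ℝ) ^ t ≤ (2 * K + 1) ^ t := by gcongr; linarith
    have h5 : (1 : ℝ) ≤ (2 * K + 1) ^ t := one_le_pow₀ (by linarith)
    have h6 : 2 * K * 2 ^ t ≤ 2 * K * (2 * K + 1) ^ t := by gcongr
    rw [pow_succ] at h3
    linarith
  have h2 : 2 * 2 ^ t ≤ √(sqNorm (bonacciVec k n)) := by
    have := h1.trans (hlow n)
    have h3 : K * (2 * 2 ^ t) ≤ K * √(sqNorm (bonacciVec k n)) := by linarith
    exact le_of_mul_le_mul_left h3 (by linarith)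
  have h3 : ((2 : ℝ) * 2 ^ t) ^ 2 ≤ sqNorm (bonacciVec k n) :=
    (Real.le_sqrt (by positivity) (by positivity)).mp h2
  have h4 : (2 * 2 ^ t) ^ 2 ≤ sqNorm (bonacciVec k n) := by exact_mod_cast h3
  have h5 : 1 ≤ 2 ^ t := Nat.one_le_two_pow
  nlinarith

/-! ### Timed computations -/

section Timed

variable {α β : Type}

@[simp] theorem val_bind (x : Timed α) (f : α → Timed β) : (x >>= f).val = (f x.val).val := rfl
@[simp] theorem cost_bind (x : Timed α) (f : α → Timed β) :
    (x >>= f).cost = x.cost + (f x.val).cost := rfl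
@[simp] theorem val_pure (a : α) : (pure a : Timed α).val = a := rfl
@[simp] theorem cost_pure (a : α) : (pure a : Timed α).cost = 0 := rfl
@[simp] theorem cost_tick (c : ℕ) : (tick c).cost = c := rfl
@[simp] theorem val_op (a : α) : (op a).val = a := rfl
@[simp] theorem cost_op (a : α) : (op a).cost = 1 := rfl

theorem val_foldlM (f : β → α → Timed β) (l : List α) (b : β) :
    (l.foldlM f b).val = l.foldl (fun b a => (f b a).val) b := by
  induction l generalizing b with
  | nil => rfl
  | cons a l ih => simp [ih]

theorem cost_foldlM (f : β → α → Timed β) (c : ℕ) (hf : ∀ b a, (f b a).cost = c) (l : List α)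
    (b : β) : (l.foldlM f b).cost = l.length * c := by
  induction l generalizing b with
  | nil => simp
  | cons a l ih => simp [ih, hf]; ring

end Timed

@[simp] theorem val_subT (v w : Vec k) : (subT v w).val = v - w := rfl
@[simp] theorem cost_subT (v w : Vec k) : (subT v w).cost = k - 1 := rfl
@[simp] theorem val_sqNormT (v : Vec k) : (sqNormT v).val = sqNorm v := rfl
@[simp] theorem cost_sqNormT (v : Vec k) : (sqNormT v).cost = 2 * (k - 1) := rfl
@[simp] theorem val_replicateT (c a : ℕ) : (replicateT c a).val = List.replicate c a := rfl
@[simp] theorem cost_replicateT (c a : ℕ) : (replicateT c a).cost = c + 1 := rfl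

/-! ### The table -/

/-- The table of the vectors `X_{-n}` with `n < m`, largest `n` first. -/
def bonacciTable (k m : ℕ) : List (ℕ × Vec k) :=
  (List.range m).reverse.map fun n => (n, bonacciVec k n)

theorem length_bonacciTable (m : ℕ) : (bonacciTable k m).length = m := by simp [bonacciTable]

theorem bonacciTable_succ (m : ℕ) :
    bonacciTable k (m + 1) = (m, bonacciVec k m) :: bonacciTable k m := by
  simp [bonacciTable, List.range_succ]

theorem mem_bonacciTable {m : ℕ} {e : ℕ × Vec k} :
    e ∈ bonacciTable k m ↔ e.1 < m ∧ e.2 = bonacciVec k e.1 := by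
  rcases e with ⟨n, X⟩
  simp [bonacciTable, eq_comm]

theorem bonacciTable_getElem (m i : ℕ) (hi : i < (bonacciTable k m).length) :
    (bonacciTable k m)[i] = (m - 1 - i, bonacciVec k (m - 1 - i)) := by
  simp [bonacciTable]

theorem initTable_val : (initTable k).val = bonacciTable k k := by
  refine List.map_congr_left fun n hn => ?_
  have hn : n < k := by simpa using hn
  rcases Nat.eq_zero_or_pos n with rfl | h0
  · simp [bonacciVec_zero]
  · rw [dif_pos ⟨h0, hn⟩, bonacciVec_of_lt h0 hn]

theorem foldl_sub_eq (l : List (ℕ × Vec k)) (X : Vec k) :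
    l.foldl (fun acc e => acc - e.2) X = X - (l.map Prod.snd).sum := by
  induction l generalizing X with
  | nil => simp
  | cons a l ih => simp [ih, sub_sub]

theorem nextEntry_val (hk : 2 ≤ k) {m : ℕ} (hm : k ≤ m) :
    (nextEntry k (bonacciTable k m)).val = bonacciTable k (m + 1) := by
  have hhead : ((bonacciTable k m).headD (0, 0)).1 + 1 = m := by
    obtain ⟨l, rfl⟩ : ∃ l, m = l + 1 := ⟨m - 1, by omega⟩
    simp [bonacciTable_succ]
  have hget : ((bonacciTable k m).getD (k - 1) (0, 0)).2 = bonacciVec k (m - k) := by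
    rw [List.getD_eq_getElem _ _ (by rw [length_bonacciTable]; omega), bonacciTable_getElem]
    change bonacciVec k (m - 1 - (k - 1)) = _
    congr 1
    omega
  have htake : ((bonacciTable k m).take (k - 1)).map Prod.snd
      = (List.range (k - 1)).map fun i => bonacciVec k (m - 1 - i) := by
    apply List.ext_getElem
    · simp [length_bonacciTable]; omega
    · intro i h1 h2
      simp [bonacciTable_getElem]
  have hsum : ((List.range (k - 1)).map fun i => bonacciVec k (m - 1 - i)).sum
      = ∑ i ∈ range (k - 1), bonacciVec k (m - 1 - i) := by
    simp [Finset.sum, Multiset.range]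
  simp only [nextEntry, val_bind, val_pure, val_foldlM, val_subT]
  rw [foldl_sub_eq, hhead, hget, htake, hsum, ← bonacciVec_of_le hk hm, bonacciTable_succ]

theorem nextEntry_cost (T : List (ℕ × Vec k)) : (nextEntry k T).cost ≤ k * k + k + 2 := by
  simp only [nextEntry, cost_bind, cost_pure, cost_tick]
  rw [cost_foldlM _ (k - 1) fun _ _ => cost_subT _ _]
  have h1 : (T.take (k - 1)).length * (k - 1) ≤ k * k :=
    Nat.mul_le_mul ((List.length_take_le _ _).trans (by omega)) (by omega)
  omega

theorem extendTable_val (hk : 2 ≤ k) (A : ℕ) {m : ℕ} (hm : k ≤ m) :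
    (extendTable k A (bonacciTable k m)).val = bonacciTable k (m + A) := by
  induction A generalizing m with
  | zero => simp [extendTable]
  | succ A ih =>
    simp only [extendTable, val_bind]
    rw [nextEntry_val hk hm, ih (by omega), add_right_comm, add_assoc]

theorem extendTable_cost (A : ℕ) (T : List (ℕ × Vec k)) :
    (extendTable k A T).cost ≤ A * (k * k + k + 2) := by
  induction A generalizing T with
  | zero => simp [extendTable]
  | succ A ih =>
    simp only [extendTable, cost_bind]
    have h1 := nextEntry_cost T
    have h2 := ih (nextEntry k T).val
    rw [add_mul, one_mul]
    omega

/-- Here t counts the doublings of `p`. The lower bound on p · 2^t lets the table reach far enough;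
the upper bound keeps its size logarithmic in `b`. -/
theorem growTable_spec (hk : 2 ≤ k) (A b p : ℕ) (hp : 0 < p) {m : ℕ} (hm : k ≤ m) :
    ∃ t, b < p * 2 ^ t ∧ p * 2 ^ t ≤ max p (2 * b) ∧
      (growTable k A b p (bonacciTable k m)).val = bonacciTable k (m + A * (t + 1)) ∧
      (growTable k A b p (bonacciTable k m)).cost ≤ (A * (k * k + k + 2) + 2) * (t + 1) := by
  generalize hd : b + 1 - p = d
  induction d using Nat.strong_induction_on generalizing p m with
  | _ d ih =>
    by_cases hpb : p ≤ b
    · obtain ⟨t, h1, h2, h3, h4⟩ :=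
        ih (b + 1 - 2 * p) (by omega) (2 * p) (by omega)
          (by omega : k ≤ m + A) rfl
      have e : p * 2 ^ (t + 1) = 2 * p * 2 ^ t := by rw [pow_succ]; ring
      refine ⟨t + 1, by rw [e]; exact h1, ?_, ?_, ?_⟩
      · rw [e]; exact h2.trans (by omega)
      · rw [growTable]
        simp only [val_bind, dif_pos (And.intro hp hpb)]
        rw [extendTable_val hk A hm, h3]
        congr 1
        ring
      · rw [growTable]
        simp only [cost_bind, dif_pos (And.intro hp hpb), cost_tick]
        rw [extendTable_val hk A hm]
        have := extendTable_cost A (bonacciTable k m)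
        rw [mul_add _ (t + 1) 1, mul_one]
        omega
    · refine ⟨0, by omega, by simp, ?_, ?_⟩
      · rw [growTable]
        simp only [val_bind, dif_neg (fun h : 0 < p ∧ p ≤ b => hpb h.2)]
        rw [extendTable_val hk A hm]
        simp
      · rw [growTable]
        simp only [cost_bind, dif_neg (fun h : 0 < p ∧ p ≤ b => hpb h.2), cost_tick]
        have := extendTable_cost A (bonacciTable k m)
        omega

theorem filterTable_val (b : ℕ) (T : List (ℕ × Vec k)) :
    (filterTable b T).val = T.filter fun e => decide (1 ≤ e.1 ∧ sqNorm e.2 ≤ b) := by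
  induction T with
  | nil => rfl
  | cons e T ih =>
    rw [List.filter_cons, ← ih]
    by_cases h : 1 ≤ e.1 ∧ sqNorm e.2 ≤ b
    · rw [if_pos (decide_eq_true h)]
      simp only [filterTable, val_bind]
      exact congrArg Timed.val (if_pos h)
    · rw [if_neg (by simpa using h)]
      simp only [filterTable, val_bind]
      exact (congrArg Timed.val (if_neg h)).trans (val_pure _)

theorem filterTable_cost (b : ℕ) (T : List (ℕ × Vec k)) :
    (filterTable b T).cost = T.length * (2 * (k - 1) + 3) := by
  induction T with
  | nil => simp [filterTable]
  | cons e T ih =>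
    have : ∀ (c : Prop) [Decidable c] (x y : List (ℕ × Vec k)),
        (if c then (pure x : Timed _) else pure y).cost = 0 := by
      intro c _ x y; split <;> rfl
    simp only [filterTable, cost_bind, cost_sqNormT, cost_tick, this, ih, List.length_cons]
    ring

/-- The lists of candidates contain all vectors in question. -/
def IsCandidates (s : ℕ) (cs : List (ℕ × Vec k)) : Prop :=
  (∀ e ∈ cs, 1 ≤ e.1 ∧ e.2 = bonacciVec k e.1) ∧
    ∀ n, 1 ≤ n → sqNorm (bonacciVec k n) ≤ 4 * s → (n, bonacciVec k n) ∈ cs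

/-- `A` is large enough for the table to reach beyond the double norm. -/
def IsTableConstant (k A : ℕ) : Prop :=
  ∀ b t n : ℕ, b < 2 ^ t → A * (t + 1) ≤ n → 4 * b < sqNorm (bonacciVec k n)

theorem candidates_spec (hk : 2 ≤ k) {A : ℕ} (hA : IsTableConstant k A) {s : ℕ} (hs : 1 ≤ s) :
    ∃ t, 2 ^ t ≤ 2 * s ∧ IsCandidates s (candidates k A s).val ∧
      (candidates k A s).val.length ≤ k + A * (t + 1) ∧
      (∀ e ∈ (candidates k A s).val, e.1 ≤ k + A * (t + 1)) ∧
      (candidates k A s).cost ≤ k * k + (A * (k * k + k + 2) + 2) * (t + 1) + 1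
        + (k + A * (t + 1)) * (2 * k + 3) := by
  obtain ⟨t, h1, h2, h3, h4⟩ := growTable_spec hk A s 1 one_pos (le_refl k)
  rw [one_mul] at h1 h2
  have hval : (candidates k A s).val = (bonacciTable k (k + A * (t + 1))).filter
      fun e => decide (1 ≤ e.1 ∧ sqNorm e.2 ≤ 4 * s) := by
    simp only [candidates, val_bind, filterTable_val, val_op]
    rw [initTable_val, h3]
  refine ⟨t, by omega, ⟨?_, ?_⟩, ?_, ?_, ?_⟩
  · intro e he
    rw [hval, List.mem_filter, mem_bonacciTable] at he
    simp only [decide_eq_true_eq] at he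
    exact ⟨he.2.1, he.1.2⟩
  · intro n hn hle
    rw [hval, List.mem_filter, mem_bonacciTable]
    refine ⟨⟨?_, rfl⟩, by simpa using ⟨hn, hle⟩⟩
    by_contra! hcon
    have := hA s t n h1 (by simp only at hcon; omega)
    omega
  · rw [hval]
    exact (List.length_filter_le _ _).trans (length_bonacciTable _).le
  · intro e he
    rw [hval, List.mem_filter, mem_bonacciTable] at he
    exact he.1.1.le
  · simp only [candidates, cost_bind, cost_op, filterTable_cost, val_op]
    rw [initTable_val, h3, length_bonacciTable]
    have h5 : (initTable k).cost = k * k := rfl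
    have h6 : (k + A * (t + 1)) * (2 * (k - 1) + 3) ≤ (k + A * (t + 1)) * (2 * k + 3) :=
      Nat.mul_le_mul_left _ (by omega)
    omega

/-! ### Closest vectors -/

theorem closest_cons_val (tie : Vec k → ℕ → ℕ → Bool) (v : Vec k) (best : ℕ × Vec k) (db : ℕ)
    (e : ℕ × Vec k) (T : List (ℕ × Vec k)) :
    (closest tie v best db (e :: T)).val
      = if sqNorm (v - e.2) < db ∨ (sqNorm (v - e.2) = db ∧ tie v e.1 best.1 = true)
        then (closest tie v e (sqNorm (v - e.2)) T).val else (closest tie v best db T).val := by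
  by_cases h : sqNorm (v - e.2) < db ∨ (sqNorm (v - e.2) = db ∧ tie v e.1 best.1 = true)
  · rw [if_pos h]
    simp only [closest, val_bind]
    exact congrArg Timed.val (if_pos h)
  · rw [if_neg h]
    simp only [closest, val_bind]
    exact congrArg Timed.val (if_neg h)

theorem closest_mem (tie : Vec k → ℕ → ℕ → Bool) (v : Vec k) (best : ℕ × Vec k) (db : ℕ)
    (T : List (ℕ × Vec k)) : (closest tie v best db T).val ∈ best :: T := by
  induction T generalizing best db with
  | nil => simp [closest]
  | cons e T ih =>
    rw [closest_cons_val]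
    split
    · exact List.mem_cons_of_mem _ (ih _ _)
    · rcases List.mem_cons.mp (ih best db) with h | h
      · rw [h]; exact List.mem_cons_self
      · exact List.mem_cons_of_mem _ (List.mem_cons_of_mem _ h)

theorem closest_le (tie : Vec k → ℕ → ℕ → Bool) (v : Vec k) (best : ℕ × Vec k) (db : ℕ)
    (hdb : db = sqNorm (v - best.2)) (T : List (ℕ × Vec k)) :
    ∀ e ∈ best :: T, sqNorm (v - (closest tie v best db T).val.2) ≤ sqNorm (v - e.2) := by
  induction T generalizing best db with
  | nil => simp [closest]
  | cons e T ih =>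
    rw [closest_cons_val]
    by_cases h : sqNorm (v - e.2) < db ∨ sqNorm (v - e.2) = db ∧ tie v e.1 best.1 = true
    · rw [if_pos h]
      have ih := ih e _ rfl
      intro f hf
      rcases List.mem_cons.mp hf with rfl | hf
      · exact (ih e List.mem_cons_self).trans (by omega)
      · exact ih f hf
    · rw [if_neg h]
      have ih := ih best db hdb
      intro f hf
      rcases List.mem_cons.mp hf with rfl | hf
      · exact ih _ List.mem_cons_self
      · rcases List.mem_cons.mp hf with rfl | hf
        · exact (ih best List.mem_cons_self).trans (by omega)
        · exact ih f (List.mem_cons_of_mem _ hf)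

/-- The tie-breaking rule that prefers the index `ch v`. -/
def preferTie (ch : Vec k → ℕ) : Vec k → ℕ → ℕ → Bool := fun v n _ => decide (n = ch v)

/-- The preferred entry attains the minimum, so it wins or ties when it is met and is never strictly
beaten afterwards; ties can replace it only by an entry of the same index, which carries the same
vector. -/
theorem closest_preferTie (ch : Vec k → ℕ) (v : Vec k) (best : ℕ × Vec k) (db : ℕ)
    (hdb : db = sqNorm (v - best.2)) (T : List (ℕ × Vec k)) (X : Vec k)
    (hmem : best.1 = ch v ∨ (ch v, X) ∈ T)
    (hmin : ∀ e ∈ best :: T, sqNorm (v - X) ≤ sqNorm (v - e.2))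
    (hX : ∀ e ∈ best :: T, e.1 = ch v → e.2 = X) :
    (closest (preferTie ch) v best db T).val.1 = ch v := by
  induction T generalizing best db with
  | nil => simpa [closest] using hmem
  | cons e T ih =>
    rw [closest_cons_val]
    have hmin_e := hmin e (by simp)
    by_cases h : sqNorm (v - e.2) < db ∨
        sqNorm (v - e.2) = db ∧ preferTie ch v e.1 best.1 = true
    · rw [if_pos h]
      refine ih e _ rfl ?_ (fun f hf => hmin f (List.mem_cons_of_mem _ hf))
        (fun f hf => hX f (List.mem_cons_of_mem _ hf))
      rcases hmem with hb | hmem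
      · left
        rcases h with h | h
        · rw [hdb, hX best (by simp) hb] at h
          omega
        · simpa [preferTie] using h.2
      · rcases List.mem_cons.mp hmem with rfl | hmem
        · exact Or.inl rfl
        · exact Or.inr hmem
    · rw [if_neg h]
      refine ih best db hdb ?_ (fun f hf => hmin f ?_) (fun f hf => hX f ?_)
      · rcases hmem with hb | hmem
        · exact Or.inl hb
        · rcases List.mem_cons.mp hmem with rfl | hmem
          · exfalso
            apply h
            have := hmin best (by simp)
            simp only [preferTie, decide_true, and_true]
            omega
          · exact Or.inr hmem
      all_goals
        rcases List.mem_cons.mp hf with rfl | hf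
        · exact List.mem_cons_self
        · exact List.mem_cons_of_mem _ (List.mem_cons_of_mem _ hf)

theorem closest_cost (tie : Vec k → ℕ → ℕ → Bool) (v : Vec k) (best : ℕ × Vec k) (db : ℕ)
    (T : List (ℕ × Vec k)) :
    (closest tie v best db T).cost ≤ T.length * (3 * k + 3) := by
  induction T generalizing best db with
  | nil => simp [closest]
  | cons e T ih =>
    simp only [closest, cost_bind, cost_subT, cost_sqNormT, cost_tick, List.length_cons]
    rw [add_mul, one_mul]
    split
    · have := ih e (sqNorm (v - e.2))
      simp only [val_subT, val_sqNormT]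
      omega
    · have := ih best db
      omega

/-! ### The rounds of the large steps procedure -/

/-- `Rounds v l w`: a run of the large steps from `v` may use the steps `l` and end with `w`. -/
inductive Rounds {k : ℕ} : Vec k → List ℕ → Vec k → Prop
  | step (v : Vec k) (n : ℕ) (l : List ℕ) (w : Vec k) (hn : IsClosest v n)
      (hlt : sqNorm (v - bonacciVec k n) < sqNorm v)
      (hrun : Rounds (v - bonacciVec k n) l w) : Rounds v (n :: l) w
  | final (v : Vec k) (h : ∀ n, 1 ≤ n → sqNorm v ≤ sqNorm (v - bonacciVec k n)) : Rounds v [] v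

theorem exists_isClosest (v : Vec k) : ∃ n, IsClosest v n := by
  have hne : ∃ d, ∃ n, 1 ≤ n ∧ sqNorm (v - bonacciVec k n) = d := ⟨_, 1, le_rfl, rfl⟩
  classical
  obtain ⟨n, hn, hd⟩ := Nat.find_spec hne
  exact ⟨n, hn, fun m hm => by rw [hd]; exact Nat.find_min' hne ⟨m, hm, rfl⟩⟩

/-- Separates the large steps, whose number is to be bounded, from the final small steps. Stopping
at a closest vector means that no vector shortens. -/
theorem largeStepsRun_iff {v : Vec k} {ns : List ℕ} :
    LargeStepsRun v ns ↔ ∃ l w, Rounds v l w ∧ ns = l ++ smallSteps w := by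
  constructor
  · intro h
    induction h with
    | step v n ns hn hlt _ ih =>
      obtain ⟨l, w, h, rfl⟩ := ih
      exact ⟨n :: l, w, .step v n l w hn hlt h, rfl⟩
    | final v n hn hle => exact ⟨[], v, .final v fun m hm => hle.trans (hn.2 m hm), rfl⟩
  · rintro ⟨l, w, h, rfl⟩
    induction h with
    | step v n l w hn hlt _ ih => exact .step v n _ hn hlt ih
    | final v h =>
      obtain ⟨n, hn⟩ := exists_isClosest v
      exact .final v n hn (h n hn.1)

theorem Rounds.final_spec {v : Vec k} {l : List ℕ} {w : Vec k} (h : Rounds v l w) :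
    sqNorm w ≤ sqNorm v ∧ ∀ n, 1 ≤ n → sqNorm w ≤ sqNorm (w - bonacciVec k n) := by
  induction h with
  | step v n l w _ hlt _ ih => exact ⟨ih.1.trans hlt.le, ih.2⟩
  | final v h => exact ⟨le_rfl, h⟩

/-- The number of rounds is bounded by any potential that drops by `1` in each large step. -/
theorem Rounds.length_le {v : Vec k} {l : List ℕ} {w : Vec k} (h : Rounds v l w) (Φ : ℕ → ℝ)
    (hΦ : Monotone Φ) (hΦ0 : ∀ s, 0 ≤ Φ s) (Θ : ℕ)
    (hdrop : ∀ v : Vec k, Θ < sqNorm v →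
      ∃ n, 1 ≤ n ∧ Φ (sqNorm (v - bonacciVec k n)) + 1 ≤ Φ (sqNorm v)) :
    (l.length : ℝ) ≤ Θ + 1 + Φ (sqNorm v) ∧ l.length ≤ sqNorm v := by
  induction h with
  | step v n l w hn hlt _ ih =>
    have hlen : (n :: l).length ≤ sqNorm v := by
      have := ih.2
      rw [List.length_cons]; omega
    refine ⟨?_, hlen⟩
    -- Above Θ the closest vector does at least as well as the witness, by monotonicity of Φ. From Θ
    -- on, the strictly decreasing integer `sqNorm` allows at most Θ further rounds.
    by_cases hΘ : Θ < sqNorm v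
    · obtain ⟨m, hm, hle⟩ := hdrop v hΘ
      have h1 := hΦ (hn.2 m hm)
      have h2 := ih.1
      rw [List.length_cons]
      push_cast
      linarith
    · have h1 : ((n :: l).length : ℝ) ≤ Θ := by exact_mod_cast (by omega : (n :: l).length ≤ Θ)
      have := hΦ0 (sqNorm v)
      linarith
  | final v h =>
    have := hΦ0 (sqNorm v)
    refine ⟨?_, Nat.zero_le _⟩
    simp only [List.length_nil, Nat.cast_zero]
    positivity

theorem sqNorm_pos {v : Vec k} (hv : v ≠ 0) : 1 ≤ sqNorm v := by
  obtain ⟨i, hi⟩ := Function.ne_iff.mp hv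
  refine le_trans ?_ (single_le_sum (f := fun i => (v i).natAbs ^ 2) (fun _ _ => Nat.zero_le _)
    (mem_univ i))
  have : (v i).natAbs ≠ 0 := by simpa using hi
  exact Nat.one_le_pow _ _ (by omega)

theorem sqrt_sqNorm_sub_le (v X : Vec k) : √(sqNorm X) ≤ √(sqNorm v) + √(sqNorm (v - X)) := by
  have h : ∀ u : Vec k, √(sqNorm u) = ‖WithLp.toLp 2 (fun i => (u i : ℝ))‖ := fun u => by
    rw [cast_sqNorm, EuclideanSpace.norm_eq]
    simp
  rw [h, h, h]
  have : WithLp.toLp 2 (fun i => (X i : ℝ)) = WithLp.toLp 2 (fun i => (v i : ℝ))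
      - WithLp.toLp 2 (fun i => ((v - X) i : ℝ)) := by
    ext i
    simp
  rw [this]
  exact norm_sub_le _ _

/-- A step that does not make the vector longer is a candidate. -/
theorem sqNorm_le_of_sub_le {v X : Vec k} (h : sqNorm (v - X) ≤ sqNorm v) :
    sqNorm X ≤ 4 * sqNorm v := by
  have h1 := sqrt_sqNorm_sub_le v X
  have h2 : √(sqNorm (v - X)) ≤ √(sqNorm v) := Real.sqrt_le_sqrt (by exact_mod_cast h)
  have h3 : √(sqNorm X) ≤ 2 * √(sqNorm v) := by linarith
  rw [Real.sqrt_le_left (by positivity), mul_pow, Real.sq_sqrt (by positivity)] at h3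
  have h4 : ((sqNorm X : ℕ) : ℝ) ≤ ((4 * sqNorm v : ℕ) : ℝ) := by push_cast; linarith
  exact_mod_cast h4

theorem IsCandidates.mono {s s' : ℕ} {cs : List (ℕ × Vec k)} (h : IsCandidates s cs)
    (hs : s' ≤ s) : IsCandidates s' cs :=
  ⟨h.1, fun n hn hle => h.2 n hn (by omega)⟩

/-- One round of the search. -/
theorem IsCandidates.closest_spec {e₀ : ℕ × Vec k} {T : List (ℕ × Vec k)} {v : Vec k}
    (h : IsCandidates (sqNorm v) (e₀ :: T)) (tie : Vec k → ℕ → ℕ → Bool) :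
    let e := (closest tie v e₀ (sqNorm (v - e₀.2)) T).val
    e ∈ e₀ :: T ∧ 1 ≤ e.1 ∧ e.2 = bonacciVec k e.1 ∧
    (sqNorm (v - e.2) < sqNorm v → IsClosest v e.1) ∧
    (¬ sqNorm (v - e.2) < sqNorm v → ∀ n, 1 ≤ n → sqNorm v ≤ sqNorm (v - bonacciVec k n)) := by
  intro e
  have hmem : e ∈ e₀ :: T := closest_mem tie v e₀ _ T
  have hle := closest_le tie v e₀ _ rfl T
  obtain ⟨h1, h2⟩ := h.1 e hmem
  refine ⟨hmem, h1, h2, ?_, ?_⟩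
  · intro hlt
    refine ⟨h1, fun m hm => ?_⟩
    rw [← h2]
    -- If this fails, X_{-m} may be missing from the table, but it lengthens `v` and so loses
    -- against the step found.
    by_cases hm' : sqNorm (v - bonacciVec k m) ≤ sqNorm v
    · exact hle _ (h.2 m hm (sqNorm_le_of_sub_le hm'))
    · omega
  · intro hge n hn
    by_contra! hcon
    have := hle _ (h.2 n hn (sqNorm_le_of_sub_le hcon.le))
    simp only at this
    exact hge (lt_of_le_of_lt this hcon)

section

variable (tie : Vec k → ℕ → ℕ → Bool) (e₀ : ℕ × Vec k) (T : List (ℕ × Vec k)) (v : Vec k)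

/-- The two extra units besides `T.length` pay for the distance to `e₀` and for forming the new
vector with its norm. -/
theorem largeSteps_of_lt
    (h : sqNorm (v - (closest tie v e₀ (sqNorm (v - e₀.2)) T).val.2) < sqNorm v) :
    (largeSteps tie e₀ T v (sqNorm v)).val =
        ((closest tie v e₀ (sqNorm (v - e₀.2)) T).val.1 ::
          (largeSteps tie e₀ T (v - (closest tie v e₀ (sqNorm (v - e₀.2)) T).val.2)
            (sqNorm (v - (closest tie v e₀ (sqNorm (v - e₀.2)) T).val.2))).val.1,
          (largeSteps tie e₀ T (v - (closest tie v e₀ (sqNorm (v - e₀.2)) T).val.2)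
            (sqNorm (v - (closest tie v e₀ (sqNorm (v - e₀.2)) T).val.2))).val.2) ∧
      (largeSteps tie e₀ T v (sqNorm v)).cost ≤
        (largeSteps tie e₀ T (v - (closest tie v e₀ (sqNorm (v - e₀.2)) T).val.2)
            (sqNorm (v - (closest tie v e₀ (sqNorm (v - e₀.2)) T).val.2))).cost
          + (T.length + 2) * (3 * k + 3) := by
  have hc := closest_cost tie v e₀ (sqNorm (v - e₀.2)) T
  constructor
  · rw [largeSteps]
    simp only [val_bind]
    exact (congrArg Timed.val (dif_pos h)).trans rfl
  · rw [largeSteps]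
    simp only [cost_bind, cost_subT, cost_sqNormT, cost_tick]
    have hk : k - 1 + (2 * (k - 1) + (T.length * (3 * k + 3) + (k - 1 + (2 * (k - 1) + (1 + 1)))))
        ≤ (T.length + 2) * (3 * k + 3) := by rw [add_mul]; omega
    refine le_trans (le_of_eq (congrArg (fun c => k - 1 + (2 * (k - 1)
      + ((closest tie v e₀ (sqNorm (v - e₀.2)) T).cost + (k - 1 + (2 * (k - 1) + (1 + c))))))
      ((congrArg Timed.cost (dif_pos h)).trans (Eq.refl
        ((largeSteps tie e₀ T (v - (closest tie v e₀ (sqNorm (v - e₀.2)) T).val.2)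
          (sqNorm (v - (closest tie v e₀ (sqNorm (v - e₀.2)) T).val.2))).cost + (1 + 0)))))) ?_
    omega

theorem largeSteps_of_not_lt
    (h : ¬ sqNorm (v - (closest tie v e₀ (sqNorm (v - e₀.2)) T).val.2) < sqNorm v) :
    (largeSteps tie e₀ T v (sqNorm v)).val = ([], v) ∧
      (largeSteps tie e₀ T v (sqNorm v)).cost ≤ (T.length + 2) * (3 * k + 3) := by
  have hc := closest_cost tie v e₀ (sqNorm (v - e₀.2)) T
  constructor
  · rw [largeSteps]
    simp only [val_bind]
    exact (congrArg Timed.val (dif_neg h)).trans rfl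
  · rw [largeSteps]
    simp only [cost_bind, cost_subT, cost_sqNormT, cost_tick]
    have hk : k - 1 + (2 * (k - 1) + (T.length * (3 * k + 3) + (k - 1 + (2 * (k - 1) + (1 + 0)))))
        ≤ (T.length + 2) * (3 * k + 3) := by rw [add_mul]; omega
    refine le_trans (le_of_eq (congrArg (fun c => k - 1 + (2 * (k - 1)
      + ((closest tie v e₀ (sqNorm (v - e₀.2)) T).cost + (k - 1 + (2 * (k - 1) + (1 + c))))))
      ((congrArg Timed.cost (dif_neg h)).trans (cost_pure _)))) ?_
    omega

end

/-- Every run of the program is a run of the procedure. -/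
theorem rounds_largeSteps (tie : Vec k → ℕ → ℕ → Bool) (e₀ : ℕ × Vec k) (T : List (ℕ × Vec k))
    (v : Vec k) (h : IsCandidates (sqNorm v) (e₀ :: T)) :
    Rounds v (largeSteps tie e₀ T v (sqNorm v)).val.1 (largeSteps tie e₀ T v (sqNorm v)).val.2 ∧
    (∀ n ∈ (largeSteps tie e₀ T v (sqNorm v)).val.1, n ∈ (e₀ :: T).map Prod.fst) ∧
    (largeSteps tie e₀ T v (sqNorm v)).cost ≤
      ((largeSteps tie e₀ T v (sqNorm v)).val.1.length + 1) * ((T.length + 2) * (3 * k + 3)) := by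
  generalize hs : sqNorm v = s
  induction s using Nat.strong_induction_on generalizing v with
  | _ s ih =>
    subst hs
    obtain ⟨h0, h1, h2, h3, h4⟩ := h.closest_spec tie
    by_cases hlt : sqNorm (v - (closest tie v e₀ (sqNorm (v - e₀.2)) T).val.2) < sqNorm v
    · obtain ⟨e1, e2⟩ := largeSteps_of_lt tie e₀ T v hlt
      obtain ⟨i1, i2, i3⟩ := ih _ hlt _ (h.mono hlt.le) rfl
      rw [e1]
      refine ⟨?_, ?_, ?_⟩
      · refine .step v _ _ _ (h3 hlt) (by rwa [← h2]) ?_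
        rw [← h2]
        exact i1
      · intro n hn
        rcases List.mem_cons.mp hn with rfl | hn
        · exact List.mem_map_of_mem h0
        · exact i2 n hn
      · refine e2.trans ?_
        rw [List.length_cons, add_mul _ 1, one_mul]
        exact add_le_add_left i3 _
    · obtain ⟨e1, e2⟩ := largeSteps_of_not_lt tie e₀ T v hlt
      rw [e1]
      exact ⟨.final v (h4 hlt), by simp, by simpa using e2⟩

/-- Every run of the procedure is a run of the program. -/
theorem exists_tie_of_rounds (e₀ : ℕ × Vec k) (T : List (ℕ × Vec k)) {v : Vec k} {l : List ℕ}
    {w : Vec k} (hrun : Rounds v l w) (h : IsCandidates (sqNorm v) (e₀ :: T)) :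
    ∃ ch : Vec k → ℕ, ∀ ch' : Vec k → ℕ, (∀ u, sqNorm u ≤ sqNorm v → ch' u = ch u) →
      (largeSteps (preferTie ch') e₀ T v (sqNorm v)).val = (l, w) := by
  induction hrun with
  | step v n l w hn hlt _ ih =>
    obtain ⟨ch, hch⟩ := ih (h.mono hlt.le)
    classical
    -- Norms strictly decrease along a run, so `v` does not recur and prescribing the choice at `v`
    -- does not disturb the later choices.
    refine ⟨Function.update ch v n, fun ch' hch' => ?_⟩
    have hv : ch' v = n := by rw [hch' v le_rfl, Function.update_self]
    have hmem := h.2 n hn.1 (sqNorm_le_of_sub_le hlt.le)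
    have hfst : (closest (preferTie ch') v e₀ (sqNorm (v - e₀.2)) T).val.1 = n := by
      rw [← hv]
      refine closest_preferTie ch' v e₀ _ rfl T (bonacciVec k n) ?_ ?_ ?_
      · rw [hv]
        rcases List.mem_cons.mp hmem with h | h
        · exact Or.inl (by rw [← h])
        · exact Or.inr h
      · intro e he
        rw [(h.1 e he).2]
        exact hn.2 _ (h.1 e he).1
      · intro e he hen
        rw [(h.1 e he).2, hen, hv]
    have hsnd : (closest (preferTie ch') v e₀ (sqNorm (v - e₀.2)) T).val.2 = bonacciVec k n := by
      rw [(h.closest_spec (preferTie ch')).2.2.1, hfst]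
    have e1 := (largeSteps_of_lt (preferTie ch') e₀ T v (by rw [hsnd]; exact hlt)).1
    rw [e1, hfst, hsnd, hch ch' fun u hu => ?_]
    rw [hch' u (hu.trans hlt.le), Function.update_of_ne]
    rintro rfl
    omega
  | final v hfin =>
    refine ⟨fun _ => 0, fun ch' _ => (largeSteps_of_not_lt _ e₀ T v ?_).1⟩
    obtain ⟨-, h1, h2, -⟩ := h.closest_spec (preferTie ch')
    rw [h2]
    exact not_lt.mpr (hfin _ h1)

/-! ### The small steps and the index -/

theorem foldl_max_eq_sup {n : ℕ} (f : Fin n → ℕ) :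
    (List.finRange n).foldl (fun a i => max a (f i)) 0 = univ.sup f := by
  have h1 : univ.sup f = ((List.finRange n).map f).foldr max 0 := rfl
  rw [h1, ← List.foldl_eq_foldr, List.foldl_map]

theorem foldl_append_eq {α β : Type} (g : α → List β) (l : List α) (init : List β) :
    l.foldl (fun b a => b ++ g a) init = init ++ l.flatMap g := by
  induction l generalizing init with
  | nil => simp
  | cons a l ih => simp [ih]

theorem smallStepsT_val (v : Vec k) : (smallStepsT v).val = smallSteps v := by
  simp only [smallStepsT, val_bind, val_foldlM, val_op, val_replicateT, val_pure, foldl_append_eq,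
    foldl_max_eq_sup]
  rfl

/-- Every append may rewrite the whole list, which is never longer than the final one; with only k -
1 appends the total stays linear in the output. -/
theorem cost_foldlM_append {α β : Type} (f : List β → α → Timed (List β)) (g : α → List β)
    (hval : ∀ b a, (f b a).val = b ++ g a)
    (hcost : ∀ b a, (f b a).cost ≤ (b ++ g a).length + 3) (l : List α) (init : List β) :
    (l.foldlM f init).cost ≤ l.length * ((init ++ l.flatMap g).length + 3) := by
  induction l generalizing init with
  | nil => simp
  | cons a l ih =>
    have h1 := hcost init a
    have h2 := ih (init ++ g a)
    rw [List.foldlM_cons, cost_bind, hval, List.flatMap_cons, List.length_cons, add_mul, one_mul,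
      ← List.append_assoc]
    have h3 : (init ++ g a).length ≤ (init ++ g a ++ l.flatMap g).length := by simp
    omega

theorem smallStepsT_cost (v : Vec k) :
    (smallStepsT v).cost ≤ (k + 1) * ((smallSteps v).length + 5) := by
  have hm : ((List.finRange (k - 1)).foldlM (fun (a : ℕ) i => do
      tick 1
      op (max a (-(v i)).toNat)) 0 : Timed ℕ).val = negMax v := by
    simp only [val_foldlM, val_bind, val_op, foldl_max_eq_sup]
    rfl
  simp only [smallStepsT, cost_bind, hm, val_replicateT, cost_replicateT]
  rw [cost_foldlM _ 2 (fun b a => rfl), List.length_finRange]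
  refine le_trans (add_le_add_right (add_le_add_right (cost_foldlM_append _
    (fun i => List.replicate (v i + negMax v).toNat ((i : ℕ) + 1)) ?_ ?_ _ _) _) _) ?_
  · intro b a
    rfl
  · intro b a
    simp only [cost_bind, cost_op, cost_replicateT, cost_tick, cost_pure, val_op,
      List.length_append, List.length_replicate]
    omega
  · rw [List.length_finRange]
    change (k - 1) * 2 + (negMax v + 1 + (k - 1) * ((smallSteps v).length + 3)) ≤ _
    have h1 : negMax v ≤ (smallSteps v).length := by simp [smallSteps]
    have h2 : (k - 1) * ((smallSteps v).length + 3) ≤ k * ((smallSteps v).length + 3) :=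
      Nat.mul_le_mul_right _ (by omega)
    have h3 : (k + 1) * ((smallSteps v).length + 5)
        = k * ((smallSteps v).length + 3) + 2 * k + (smallSteps v).length + 5 := by ring
    omega

/-- The copies of X_{-k} number at most ‖v‖₂, and those of each unit vector at most 2‖v‖₂. -/
theorem smallSteps_length (v : Vec k) :
    ((smallSteps v).length : ℝ) ≤ 2 * k * √(sqNorm v) := by
  have hneg : (negMax v : ℝ) ≤ √(sqNorm v) := by
    have : negMax v ≤ ⌊√(sqNorm v : ℝ)⌋₊ := by
      refine Finset.sup_le fun i _ => Nat.le_floor ?_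
      have h1 := abs_le_sqrt_sqNorm v i
      have h2 : ((-(v i)).toNat : ℝ) = max (-(v i) : ℝ) 0 := by
        have : (((-(v i)).toNat : ℤ) : ℝ) = ((max (-(v i)) 0 : ℤ) : ℝ) := by
          rw [Int.toNat_eq_max]
        push_cast at this
        exact this
      rw [h2]
      exact max_le ((neg_le_abs _).trans h1) (by positivity)
    exact (Nat.cast_le.mpr this).trans (Nat.floor_le (by positivity))
  have hcoord : ∀ i, (((v i + negMax v).toNat : ℕ) : ℝ) ≤ 2 * √(sqNorm v) := by
    intro i
    have h1 := abs_le_sqrt_sqNorm v i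
    have h2 : (((v i + negMax v).toNat : ℤ) : ℝ) = ((max (v i + negMax v) 0 : ℤ) : ℝ) := by
      rw [Int.toNat_eq_max]
    push_cast at h2
    rw [h2]
    refine max_le ?_ (by positivity)
    linarith [le_abs_self (v i : ℝ)]
  have hlen : (smallSteps v).length = negMax v + ∑ i, (v i + negMax v).toNat := by
    simp only [smallSteps, List.length_append, List.length_replicate, List.length_flatMap]
    rfl
  rw [hlen]
  push_cast
  have hsum : ∑ i : Fin (k - 1), (((v i + negMax v).toNat : ℕ) : ℝ)
      ≤ (k - 1 : ℕ) * (2 * √(sqNorm v)) := by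
    refine (sum_le_sum fun i _ => hcoord i).trans_eq ?_
    simp
  rcases Nat.eq_zero_or_pos k with rfl | hk
  · have : sqNorm v = 0 := by simp [sqNorm]
    rw [this] at hneg hsum ⊢
    simp at hneg hsum ⊢
    exact hneg
  · rw [Nat.cast_sub hk] at hsum
    push_cast at hsum
    linarith [Real.sqrt_nonneg (sqNorm v : ℝ)]

theorem indexBoundT_spec (ns : List ℕ) :
    (indexBoundT k ns).val = indexBound k ns ∧ (indexBoundT k ns).cost = 2 * ns.length + 3 := by
  have hfold : ∀ (ns : List ℕ) (r : ℕ × ℕ),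
      ns.foldl (fun (r : ℕ × ℕ) n => (r.1 + 1, max r.2 n)) r
        = (r.1 + ns.length, ns.foldl max r.2) := by
    intro ns
    induction ns with
    | nil => simp
    | cons a ns ih => intro r; simp [ih]; omega
  constructor
  · simp only [indexBoundT, val_bind, val_foldlM, val_pure, val_op, hfold]
    rw [indexBound, zero_add, List.foldl_eq_foldr]
  · simp only [indexBoundT, cost_bind, cost_tick, cost_pure]
    rw [cost_foldlM _ 2 (fun b a => rfl)]
    ring

theorem computeLsb_of_candidates {A : ℕ} (tie : Vec k → ℕ → ℕ → Bool) (v : Vec k)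
    {e₀ : ℕ × Vec k} {T : List (ℕ × Vec k)} (h : (candidates k A (sqNorm v)).val = e₀ :: T) :
    (computeLsb k A tie v).val
        = ((largeSteps tie e₀ T v (sqNorm v)).val.1
            ++ smallSteps (largeSteps tie e₀ T v (sqNorm v)).val.2,
          indexBound k ((largeSteps tie e₀ T v (sqNorm v)).val.1
            ++ smallSteps (largeSteps tie e₀ T v (sqNorm v)).val.2)) ∧
      (computeLsb k A tie v).cost = 2 * (k - 1) + ((candidates k A (sqNorm v)).cost
        + ((largeSteps tie e₀ T v (sqNorm v)).cost
        + ((smallStepsT (largeSteps tie e₀ T v (sqNorm v)).val.2).cost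
        + ((largeSteps tie e₀ T v (sqNorm v)).val.1.length + 1
        + (2 * ((largeSteps tie e₀ T v (sqNorm v)).val.1
            ++ smallSteps (largeSteps tie e₀ T v (sqNorm v)).val.2).length + 3 + 0))))) := by
  constructor
  · simp only [computeLsb, val_bind, val_sqNormT, h, val_pure, smallStepsT_val]
    rw [(indexBoundT_spec _).1]
  · simp only [computeLsb, cost_bind, val_sqNormT, h, cost_pure, cost_sqNormT, cost_tick,
      smallStepsT_val]
    rw [(indexBoundT_spec _).2]

/-- The unit vector X_{-1} always qualifies, so the empty branch of `computeLsb` is not reached for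
nonzero vectors. -/
theorem candidates_ne_nil (hk : 2 ≤ k) {s : ℕ} (hs : 1 ≤ s) {cs : List (ℕ × Vec k)}
    (h : IsCandidates s cs) : ∃ e₀ T, cs = e₀ :: T := by
  have hone : sqNorm (bonacciVec k 1) ≤ 4 * s := by
    have h1 : sqNorm (bonacciVec k 1) ≤ 1 := by
      rw [bonacciVec_of_lt one_pos (by omega), sqNorm,
        sum_eq_single (⟨1 - 1, by omega⟩ : Fin (k - 1))]
      · simp
      · intro j _ hj
        rw [Pi.single_eq_of_ne hj]
        simp
      · simp
    omega
  exact List.exists_cons_of_ne_nil (List.ne_nil_of_mem (h.2 1 le_rfl hone))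

/-- The program computes exactly the results of the runs of the procedure. -/
theorem largeStepsRun_iff_computeLsb (hk : 2 ≤ k) {A : ℕ} (hA : IsTableConstant k A) {v : Vec k}
    (hv : v ≠ 0) (ns : List ℕ) (j : ℕ) :
    (LargeStepsRun v ns ∧ j = indexBound k ns) ↔
      ∃ tie, (computeLsb k A tie v).val = (ns, j) := by
  obtain ⟨t, -, hcs, -⟩ := candidates_spec hk hA (sqNorm_pos hv)
  obtain ⟨e₀, T, hT⟩ := candidates_ne_nil hk (sqNorm_pos hv) hcs
  rw [hT] at hcs
  rw [largeStepsRun_iff]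
  constructor
  · rintro ⟨⟨l, w, hrun, rfl⟩, rfl⟩
    obtain ⟨ch, hch⟩ := exists_tie_of_rounds e₀ T hrun hcs
    refine ⟨preferTie ch, ?_⟩
    rw [(computeLsb_of_candidates _ v hT).1, hch ch fun _ _ => rfl]
  · rintro ⟨tie, htie⟩
    rw [(computeLsb_of_candidates tie v hT).1, Prod.mk.injEq] at htie
    refine ⟨⟨_, _, (rounds_largeSteps tie e₀ T v hcs).1, htie.1.symm⟩, ?_⟩
    rw [← htie.2, htie.1]

/-- A run of the program and its cost in terms of the size `t` of the table, the number of rounds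
and the number of small steps. -/
theorem computeLsb_spec (hk : 2 ≤ k) {A : ℕ} (hA : IsTableConstant k A) :
    ∃ D : ℕ, ∀ tie, ∀ v : Vec k, v ≠ 0 → ∃ t l w, 2 ^ t ≤ 2 * sqNorm v ∧ Rounds v l w ∧
      (computeLsb k A tie v).val = (l ++ smallSteps w, indexBound k (l ++ smallSteps w)) ∧
      indexBound k (l ++ smallSteps w) ≤ D * (t + 1 + l.length + (smallSteps w).length) ∧
      (computeLsb k A tie v).cost
        ≤ D * ((t + 1) * (l.length + 1) + (smallSteps w).length) := by
  -- The part 2k + A bounds the index. The products that follow pay for the table, the rounds and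
  -- the small steps, and the rest for passes over lists.
  refine ⟨2 * k + A + (3 * k + (k * k + (A * (k * k + k + 2) + 2) + 1 + (k + A) * (2 * k + 3))
    + (k + A + 2) * (3 * k + 3) + (k + 1) * 5 + 6), fun tie v hv => ?_⟩
  obtain ⟨t, ht, hcs, hlen, hidx, hcost⟩ := candidates_spec hk hA (sqNorm_pos hv)
  obtain ⟨e₀, T, hT⟩ := candidates_ne_nil hk (sqNorm_pos hv) hcs
  rw [hT] at hcs hlen hidx
  obtain ⟨hr1, hr2, hr3⟩ := rounds_largeSteps tie e₀ T v hcs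
  obtain ⟨hv1, hv2⟩ := computeLsb_of_candidates tie v hT
  refine ⟨t, _, _, ht, hr1, hv1, ?_, ?_⟩
  · generalize (largeSteps tie e₀ T v (sqNorm v)).val.1 = l at *
    generalize (largeSteps tie e₀ T v (sqNorm v)).val.2 = w at *
    have hmax : ∀ (ns : List ℕ) (c : ℕ), (∀ n ∈ ns, n ≤ c) → ns.foldr max 0 ≤ c := by
      intro ns c
      induction ns with
      | nil => simp
      | cons a ns ih =>
        intro h
        exact max_le (h a List.mem_cons_self) (ih fun n hn => h n (List.mem_cons_of_mem _ hn))
    have hsmall : ∀ n ∈ smallSteps w, n ≤ k := by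
      intro n hn
      simp only [smallSteps, List.mem_append, List.mem_replicate, List.mem_flatMap] at hn
      rcases hn with hn | ⟨i, -, hn⟩
      · exact hn.2.le
      · have := i.2
        omega
    have h1 : (l ++ smallSteps w).foldr max 0 ≤ k + A * (t + 1) := by
      refine hmax _ _ fun n hn => ?_
      rcases List.mem_append.mp hn with hn | hn
      · obtain ⟨e, he, rfl⟩ := List.mem_map.mp (hr2 n hn)
        exact hidx e he
      · exact (hsmall n hn).trans (by omega)
    rw [indexBound, List.length_append]
    have h2 : k * (l.length + (smallSteps w).length - 1)
        ≤ k * (l.length + (smallSteps w).length) := Nat.mul_le_mul_left _ (by omega)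
    generalize l.length = a at *
    generalize (smallSteps w).length = b at *
    generalize (3 * k + (k * k + (A * (k * k + k + 2) + 2) + 1 + (k + A) * (2 * k + 3))
      + (k + A + 2) * (3 * k + 3) + (k + 1) * 5 + 6) = E
    calc _ ≤ k * (a + b) + (k + A * (t + 1)) := add_le_add h2 h1
      _ ≤ (2 * k + A) * (t + 1 + a + b) := by
        nlinarith [Nat.zero_le (k * t), Nat.zero_le (k * (a + b)), Nat.zero_le (A * (a + b))]
      _ ≤ _ := Nat.mul_le_mul_right _ (by omega)
  · rw [hv2]
    have hs := smallStepsT_cost (largeSteps tie e₀ T v (sqNorm v)).val.2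
    rw [List.length_append]
    generalize (largeSteps tie e₀ T v (sqNorm v)).val.1.length = a at *
    generalize (smallSteps (largeSteps tie e₀ T v (sqNorm v)).val.2).length = b at *
    generalize (largeSteps tie e₀ T v (sqNorm v)).cost = x at *
    generalize (smallStepsT (largeSteps tie e₀ T v (sqNorm v)).val.2).cost = z at *
    generalize (candidates k A (sqNorm v)).cost = q at *
    rw [List.length_cons] at hlen
    have hT2 : (T.length + 2) ≤ (k + A + 2) * (t + 1) := by nlinarith [Nat.zero_le (k * t)]
    have h1 : x ≤ (k + A + 2) * (3 * k + 3) * ((t + 1) * (a + 1)) := by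
      refine hr3.trans ?_
      calc _ ≤ (a + 1) * (((k + A + 2) * (t + 1)) * (3 * k + 3)) := by gcongr
        _ = _ := by ring
    set u := (t + 1) * (a + 1) with hu
    have hu1 : t + 1 ≤ u := Nat.le_mul_of_pos_right _ (by omega)
    have hu2 : a + 1 ≤ u := Nat.le_mul_of_pos_left _ (by omega)
    have h2 : q ≤ (k * k + (A * (k * k + k + 2) + 2) + 1 + (k + A) * (2 * k + 3)) * u := by
      refine hcost.trans ?_
      have g1 : k * k ≤ k * k * u := Nat.le_mul_of_pos_right _ (by omega)
      have g2 : (A * (k * k + k + 2) + 2) * (t + 1) ≤ (A * (k * k + k + 2) + 2) * u :=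
        Nat.mul_le_mul_left _ hu1
      have g3 : (k + A * (t + 1)) * (2 * k + 3) ≤ (k + A) * (2 * k + 3) * u := by
        calc _ ≤ (k * u + A * u) * (2 * k + 3) := by
              gcongr
              exact Nat.le_mul_of_pos_right _ (by omega)
          _ = _ := by ring
      simp only [add_mul _ _ u]
      rw [add_mul] at g2
      linarith
    have h3 : z ≤ (k + 1) * 5 * (u + b) := by
      refine hs.trans ?_
      rw [mul_assoc]
      exact Nat.mul_le_mul_left _ (by omega)
    set E1 := (k + A + 2) * (3 * k + 3)
    set E2 := (k * k + (A * (k * k + k + 2) + 2) + 1 + (k + A) * (2 * k + 3))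
    set E3 := (k + 1) * 5
    have h4 : (2 * k + A + (3 * k + E2 + E1 + E3 + 6)) * (u + b)
        = E1 * u + E2 * u + E3 * (u + b) + (E1 * b + E2 * b + A * (u + b))
          + 5 * (k * (u + b)) + 6 * (u + b) := by ring
    have h5 : k ≤ k * (u + b) := Nat.le_mul_of_pos_right _ (by omega)
    rw [h4]
    omega

/-! ### The `k`-bonacci numbers -/

theorem bonacciNum_zero : bonacciNum k 0 = 0 := by rw [bonacciNum]

theorem bonacciNum_one : bonacciNum k 1 = 1 := by rw [bonacciNum]

theorem bonacciNum_succ {n : ℕ} (hn : 1 ≤ n) :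
    bonacciNum k (n + 1) = ∑ i ∈ range k, bonacciNum k (n - i) := by
  obtain ⟨m, rfl⟩ : ∃ m, n = m + 1 := ⟨n - 1, by omega⟩
  rw [bonacciNum]

theorem bonacciNum_nonneg (n : ℕ) : 0 ≤ bonacciNum k n := by
  induction n using Nat.strong_induction_on with
  | _ n ih =>
    match n with
    | 0 => rw [bonacciNum_zero]
    | 1 => rw [bonacciNum_one]; exact zero_le_one
    | n + 2 =>
      rw [bonacciNum_succ (by omega)]
      exact sum_nonneg fun i _ => ih _ (by omega)

theorem bonacciNum_le_succ (hk : 2 ≤ k) (n : ℕ) : bonacciNum k n ≤ bonacciNum k (n + 1) := by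
  rcases Nat.eq_zero_or_pos n with rfl | hn
  · rw [bonacciNum_zero]; exact bonacciNum_nonneg _
  · rw [bonacciNum_succ hn]
    exact single_le_sum (f := fun i => bonacciNum k (n - i)) (fun i _ => bonacciNum_nonneg _)
      (mem_range.mpr (by omega : 0 < k))

theorem bonacciNum_mono (hk : 2 ≤ k) : Monotone (bonacciNum k) :=
  monotone_nat_of_le_succ (bonacciNum_le_succ hk)

theorem bonacciNum_pos (hk : 2 ≤ k) {n : ℕ} (hn : 1 ≤ n) : 0 < bonacciNum k n := by
  have := bonacciNum_mono hk hn
  rw [bonacciNum_one] at this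
  omega

/-- What is left after a greedy subtraction is small. -/
theorem bonacciNum_succ_le_two_mul {n : ℕ} (hn : 2 ≤ n) :
    bonacciNum k (n + 1) ≤ 2 * bonacciNum k n := by
  obtain ⟨m, rfl⟩ : ∃ m, n = m + 1 := ⟨n - 1, by omega⟩
  have h1 : bonacciNum k (m + 1) = ∑ i ∈ range k, bonacciNum k (m - i) := bonacciNum_succ (by omega)
  have h2 : bonacciNum k (m + 1 + 1) = ∑ i ∈ range k, bonacciNum k (m + 1 - i) :=
    bonacciNum_succ (by omega)
  have h3 := sum_range_succ (fun i => bonacciNum k (m + 1 - i)) k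
  rw [sum_range_succ'] at h3
  simp only [Nat.add_sub_add_right, Nat.sub_zero] at h3
  have := bonacciNum_nonneg (k := k) (m + 1 - k)
  linarith

/-! ### The vector greedy algorithm -/

/-- The list `[x_{m-1}, …, x_0]`. -/
def bonacciList (k m : ℕ) : List ℤ := (List.range m).reverse.map (bonacciNum k)

theorem bonacciList_succ (m : ℕ) :
    bonacciList k (m + 1) = bonacciNum k m :: bonacciList k m := by
  simp [bonacciList, List.range_succ]

theorem length_bonacciList (m : ℕ) : (bonacciList k m).length = m := by simp [bonacciList]

theorem bonacciList_getD (m i : ℕ) (hi : i < m) :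
    (bonacciList k m).getD i 0 = bonacciNum k (m - 1 - i) := by
  rw [List.getD_eq_getElem _ _ (by rwa [length_bonacciList])]
  simp [bonacciList]

theorem foldl_add_eq (l : List ℤ) (a : ℤ) : l.foldl (fun a y => a + y) a = a + l.sum := by
  induction l generalizing a with
  | nil => simp
  | cons b l ih => simp [ih, add_assoc]

/-- When `n` exceeds the length of the list, the truncated indices on the right contribute only x_0
= 0. -/
theorem sum_take_bonacciList (m n : ℕ) :
    ((bonacciList k (m + 1)).take n).sum = ∑ i ∈ range n, bonacciNum k (m - i) := by
  induction m generalizing n with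
  | zero =>
    cases n with
    | zero => simp
    | succ n => simp [bonacciList, bonacciNum_zero]
  | succ m ih =>
    cases n with
    | zero => simp
    | succ n =>
      rw [bonacciList_succ, List.take_succ_cons, List.sum_cons, ih, sum_range_succ', add_comm]
      simp

theorem extendNums_val (m : ℕ) {n : ℕ} (hn : 2 ≤ n) :
    (extendNums k m (bonacciList k n)).val = bonacciList k (n + m) := by
  induction m generalizing n with
  | zero => simp [extendNums]
  | succ m ih =>
    simp only [extendNums, val_bind, val_foldlM, val_op]
    obtain ⟨l, rfl⟩ : ∃ l, n = l + 1 := ⟨n - 1, by omega⟩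
    rw [foldl_add_eq, zero_add, sum_take_bonacciList, ← bonacciNum_succ (by omega),
      ← bonacciList_succ, ih (by omega)]
    congr 1
    omega

theorem extendNums_cost (m : ℕ) (L : List ℤ) : (extendNums k m L).cost ≤ m * (k + 1) := by
  induction m generalizing L with
  | zero => simp [extendNums]
  | succ m ih =>
    simp only [extendNums, cost_bind, cost_tick]
    rw [cost_foldlM _ 1 fun _ _ => cost_op _, add_mul, one_mul, mul_one]
    have h1 := ih ((List.foldlM (fun a y => op (a + y)) 0 (L.take k) : Timed ℤ).val :: L)
    have h2 := List.length_take_le k L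
    omega

theorem foldl_zip_eq (l l' : List ℤ) (a : ℤ) :
    (l.zip l').foldl (fun a p => a + p.1 * p.2) a
      = a + ∑ i ∈ range l.length, l.getD i 0 * l'.getD i 0 := by
  induction l generalizing l' a with
  | nil => simp
  | cons b l ih =>
    cases l' with
    | nil => simp
    | cons b' l' =>
      rw [List.zip_cons_cons, List.foldl_cons, ih, List.length_cons, sum_range_succ']
      simp
      ring

theorem dotT_val (v : Vec k) (j : ℕ) :
    (dotT (List.ofFn v) (bonacciList k (j + 1))).val
      = ∑ i : Fin (k - 1), v i * bonacciNum k (j - i) := by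
  simp only [dotT, val_foldlM, val_bind, val_op]
  rw [foldl_zip_eq, zero_add, List.length_ofFn, Finset.sum_range]
  refine sum_congr rfl fun i _ => ?_
  congr 1
  · rw [List.getD_eq_getElem _ _ (by simp)]
    simp
  · by_cases h : (i : ℕ) < j + 1
    · rw [bonacciList_getD _ _ h]
      congr 1
    · rw [List.getD_eq_default _ _ (by rw [length_bonacciList]; omega),
        show j - (i : ℕ) = 0 by omega, bonacciNum_zero]

theorem dotT_cost (v : Vec k) (l : List ℤ) : (dotT (List.ofFn v) l).cost ≤ 2 * k := by
  rw [dotT, cost_foldlM _ 2 fun _ _ => rfl, List.length_zip, List.length_ofFn]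
  omega

/-- The number `q` bounds the additions, and the upper bound on the result limits the work of the
subtraction loop that follows. -/
theorem addLoop_spec (m a : ℤ) (hm : 0 < m) (q : ℕ) (hq : -(q * m) ≤ a) :
    (addLoop m a).val % m = a % m ∧ 0 ≤ (addLoop m a).val ∧ (addLoop m a).val < max (a + 1) m ∧
      (addLoop m a).cost ≤ 2 * q + 1 := by
  induction q generalizing a with
  | zero =>
    have ha : 0 ≤ a := by simpa using hq
    rw [addLoop]
    simp only [val_bind, cost_bind, cost_tick, dif_neg (fun h : 0 < m ∧ a < 0 => absurd h.2
      (not_lt.mpr ha)), val_pure, cost_pure]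
    exact ⟨trivial, ha, lt_max_of_lt_left (by omega), by omega⟩
  | succ q ih =>
    rw [addLoop]
    by_cases ha : a < 0
    · simp only [val_bind, cost_bind, cost_tick, dif_pos (And.intro hm ha)]
      obtain ⟨h1, h2, h3, h4⟩ := ih (a + m) (by push_cast at hq; linarith)
      refine ⟨by rw [h1, Int.add_emod_right], h2, h3.trans_le ?_, by omega⟩
      exact max_le (le_max_of_le_right (by omega)) (le_max_right _ _)
    · simp only [val_bind, cost_bind, cost_tick, dif_neg (fun h : 0 < m ∧ a < 0 => ha h.2),
        val_pure, cost_pure]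
      exact ⟨trivial, by omega, lt_max_of_lt_left (by omega), by omega⟩

theorem subLoop_spec (m a : ℤ) (hm : 0 < m) (ha0 : 0 ≤ a) (q : ℕ) (hq : a < (q + 1) * m) :
    (subLoop m a).val = a % m ∧ (subLoop m a).cost ≤ 2 * q + 1 := by
  induction q generalizing a with
  | zero =>
    have ha : a < m := by simpa using hq
    rw [subLoop]
    simp only [val_bind, cost_bind, cost_tick, dif_neg (fun h : 0 < m ∧ m ≤ a => absurd h.2
      (not_le.mpr ha)), val_pure, cost_pure]
    exact ⟨(Int.emod_eq_of_lt ha0 ha).symm, by omega⟩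
  | succ q ih =>
    rw [subLoop]
    by_cases ha : m ≤ a
    · simp only [val_bind, cost_bind, cost_tick, dif_pos (And.intro hm ha)]
      obtain ⟨h1, h2⟩ := ih (a - m) (by omega) (by push_cast at hq; linarith)
      exact ⟨by rw [h1, Int.sub_emod_right], by omega⟩
    · simp only [val_bind, cost_bind, cost_tick, dif_neg (fun h : 0 < m ∧ m ≤ a => ha h.2),
        val_pure, cost_pure]
      exact ⟨(Int.emod_eq_of_lt ha0 (by omega)).symm, by omega⟩

theorem modT_spec (m a : ℤ) (hm : 0 < m) (q : ℕ) (hq : |a| ≤ q * m) :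
    (modT m a).val = a % m ∧ (modT m a).cost ≤ 4 * q + 2 := by
  obtain ⟨h1, h2⟩ := abs_le.mp hq
  obtain ⟨a1, a2, a3, a4⟩ := addLoop_spec m a hm q h1
  have h3 : (addLoop m a).val < (q + 1) * m := by
    refine a3.trans_le (max_le ?_ ?_)
    · linarith
    · nlinarith [(by positivity : (0 : ℤ) ≤ q)]
  obtain ⟨s1, s2⟩ := subLoop_spec m _ hm a2 q h3
  simp only [modT, val_bind, cost_bind]
  exact ⟨by rw [s1, a1], by omega⟩

theorem greedy_cons_of_le {x r : ℤ} (L : List ℤ) (h : x ≤ r) :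
    (greedy (x :: L) r).val = true :: (greedy L (r - x)).val ∧
      (greedy (x :: L) r).cost = (greedy L (r - x)).cost + 3 := by
  constructor
  · simp only [greedy, val_bind, if_pos h, val_op, val_pure]
  · simp only [greedy, cost_bind, if_pos h, val_op, cost_op, cost_tick, cost_pure]
    omega

theorem greedy_cons_of_lt {x r : ℤ} (L : List ℤ) (h : r < x) :
    (greedy (x :: L) r).val = false :: (greedy L r).val ∧
      (greedy (x :: L) r).cost = (greedy L r).cost + 2 := by
  have h' := not_le.mpr h
  constructor
  · simp only [greedy, val_bind, if_neg h', val_pure]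
  · simp only [greedy, cost_bind, if_neg h', cost_tick, cost_pure]
    omega

theorem greedy_cost (L : List ℤ) (r : ℤ) : (greedy L r).cost ≤ 3 * L.length := by
  induction L generalizing r with
  | nil => simp [greedy]
  | cons x L ih =>
    rw [List.length_cons]
    rcases le_or_gt x r with h | h
    · rw [(greedy_cons_of_le L h).2]
      have := ih (r - x)
      omega
    · rw [(greedy_cons_of_lt L h).2]
      have := ih r
      omega

/-- The greedy numbers `[x_j, …, x_1]`. -/
theorem take_bonacciList_succ (j : ℕ) :
    (bonacciList k (j + 2)).take (j + 1)
      = bonacciNum k (j + 1) :: (bonacciList k (j + 1)).take j := by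
  rw [bonacciList_succ, List.take_succ_cons]

/-- The remainder stays below the number preceding the next one in the list, since x_{n+1} ≤ 2x_n.
By induction only a leading block of k ones must be excluded, and its numbers would add up to
x_{j+1} ≤ r for the current j. -/
theorem greedy_spec (hk : 2 ≤ k) (j : ℕ) (r : ℤ) (h0 : 0 ≤ r) (h1 : r < bonacciNum k (j + 1)) :
    let c := (greedy ((bonacciList k (j + 1)).take j) r).val
    c.length = j ∧ ¬ List.replicate k true <:+: c ∧
      ∑ i ∈ range j, (if c.getD i false then bonacciNum k (j - i) else 0) = r := by
  induction j generalizing r with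
  | zero =>
    rw [zero_add, bonacciNum_one] at h1
    have hrep : List.replicate k true ≠ [] := by simp; omega
    refine ⟨by simp [greedy], ?_, by simp; omega⟩
    simpa [greedy] using (by omega : k ≠ 0)
  | succ j ih =>
    rw [take_bonacciList_succ]
    intro c
    have hkey : c.length = j + 1 ∧ ∑ i ∈ range (j + 1),
        (if c.getD i false then bonacciNum k (j + 1 - i) else 0) = r ∧
        ∃ b c', c = b :: c' ∧ ¬ List.replicate k true <:+: c' := by
      rcases le_or_gt (bonacciNum k (j + 1)) r with h | h
      · have hj : 1 ≤ j := by
          by_contra! hj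
          have hj0 : j = 0 := by omega
          subst hj0
          rw [zero_add, bonacciNum_succ le_rfl, Finset.sum_eq_single_of_mem 0
            (mem_range.mpr (by omega))] at h1
          · simp only [Nat.sub_zero] at h1
            simp only [zero_add] at h
            omega
          · intro i _ hi
            rw [show 1 - i = 0 by omega, bonacciNum_zero]
        have h2 := bonacciNum_succ_le_two_mul (k := k) (n := j + 1) (by omega)
        obtain ⟨i1, i2, i3⟩ := ih (r - bonacciNum k (j + 1)) (by omega) (by omega)
        have hc : c = _ := (greedy_cons_of_le _ h).1
        rw [hc]
        refine ⟨by rw [List.length_cons, i1], ?_, _, _, rfl, i2⟩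
        rw [sum_range_succ']
        simp only [List.getD_cons_succ, List.getD_cons_zero, Nat.add_sub_add_right, if_true,
          Nat.sub_zero]
        rw [i3]
        ring
      · obtain ⟨i1, i2, i3⟩ := ih r h0 h
        have hc : c = _ := (greedy_cons_of_lt _ h).1
        rw [hc]
        refine ⟨by rw [List.length_cons, i1], ?_, _, _, rfl, i2⟩
        rw [sum_range_succ']
        simp only [List.getD_cons_succ, List.getD_cons_zero, Nat.add_sub_add_right,
          Bool.false_eq_true, if_false, add_zero]
        exact i3
    obtain ⟨hlen, hsum, b, c', hcc, hc'⟩ := hkey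
    refine ⟨hlen, ?_, hsum⟩
    intro hinf
    rw [hcc, List.infix_cons_iff, ← hcc] at hinf
    rcases hinf with hpre | hinf
    · have hkj : k ≤ j + 1 := by
        have := hpre.length_le
        rwa [List.length_replicate, hlen] at this
      have hget : ∀ i < k, c.getD i false = true := by
        intro i hi
        obtain ⟨d, hd⟩ := hpre
        rw [← hd, List.getD_append _ _ _ _ (by simpa using hi),
          List.getD_eq_getElem _ _ (by simpa using hi), List.getElem_replicate]
      have hle : bonacciNum k (j + 1 + 1) ≤ r := by
        rw [bonacciNum_succ (by omega), ← hsum]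
        calc ∑ i ∈ range k, bonacciNum k (j + 1 - i)
            = ∑ i ∈ range k, (if c.getD i false then bonacciNum k (j + 1 - i) else 0) :=
              sum_congr rfl fun i hi => by rw [if_pos (hget i (mem_range.mp hi))]
          _ ≤ _ := by
              refine sum_le_sum_of_subset_of_nonneg (range_mono hkj) fun i _ _ => ?_
              split
              · exact bonacciNum_nonneg _
              · exact le_rfl
      omega
    · exact hc' hinf

theorem vectorGreedy_spec (hk : 2 ≤ k) (j : ℕ) (v : Vec k) :
    IsVectorGreedyOutput k j v (vectorGreedy k j v).val ∧
      (vectorGreedy k j v).cost ≤ (k + 5) * j + (3 * k + 4) + 4 * ∑ i, (v i).natAbs := by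
  have hinit : ([1, 0] : List ℤ) = bonacciList k 2 := by
    simp [bonacciList_succ, bonacciNum_one, bonacciNum_zero]
    simp [bonacciList]
  have hL : (extendNums k j [1, 0]).val = bonacciNum k (j + 1) :: bonacciList k (j + 1) := by
    rw [hinit, extendNums_val j le_rfl, show 2 + j = j + 1 + 1 by omega, bonacciList_succ]
  have hm : 0 < bonacciNum k (j + 1) := bonacciNum_pos hk (by omega)
  -- Each x_{j-i} is at most x_{j+1}, so the reduction takes at most ‖v‖₁ additions or subtractions,
  -- independently of j, up to a constant factor.
  have hq : |∑ i : Fin (k - 1), v i * bonacciNum k (j - i)|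
      ≤ ((∑ i, (v i).natAbs : ℕ) : ℤ) * bonacciNum k (j + 1) := by
    push_cast
    rw [sum_mul]
    refine (abs_sum_le_sum_abs _ _).trans (sum_le_sum fun i _ => ?_)
    rw [abs_mul, abs_of_nonneg (bonacciNum_nonneg _)]
    exact mul_le_mul_of_nonneg_left (bonacciNum_mono hk (by omega)) (abs_nonneg _)
  obtain ⟨m1, m2⟩ := modT_spec _ _ hm _ hq
  constructor
  · simp only [vectorGreedy, val_bind, hL, List.tail_cons, List.headD_cons, dotT_val, m1]
    exact greedy_spec hk j _ (Int.emod_nonneg _ hm.ne') (Int.emod_lt_of_pos _ hm)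
  · simp only [vectorGreedy, cost_bind, hL, List.tail_cons, List.headD_cons, dotT_val, cost_tick]
    have h1 := extendNums_cost (k := k) j [1, 0]
    have h2 := dotT_cost v (bonacciList k (j + 1))
    have h3 := greedy_cost ((bonacciList k (j + 1)).take j)
      (modT (bonacciNum k (j + 1)) (∑ i : Fin (k - 1), v i * bonacciNum k (j - i))).val
    have h4 : ((bonacciList k (j + 1)).take j).length ≤ j := List.length_take_le _ _
    have h5 : (k + 5) * j = j * (k + 1) + 4 * j := by ring
    omega

/-! ### Norms and logarithms -/

theorem abs_coord_le_norm (v : Vec k) (i : Fin (k - 1)) : |(v i : ℝ)| ≤ ‖v‖ := by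
  have := norm_le_pi_norm v i
  rwa [Int.norm_eq_abs] at this

theorem sqNorm_le_norm (v : Vec k) : (sqNorm v : ℝ) ≤ k * ‖v‖ ^ 2 :=
  sqNorm_le_of_abs_le (abs_coord_le_norm v)

theorem sqrt_sqNorm_le_norm (hk : 2 ≤ k) (v : Vec k) : √(sqNorm v) ≤ k * ‖v‖ := by
  have hk' : (2 : ℝ) ≤ k := by exact_mod_cast hk
  rw [Real.sqrt_le_left (by positivity), mul_pow]
  refine (sqNorm_le_norm v).trans ?_
  gcongr
  nlinarith

theorem sum_natAbs_le_norm (v : Vec k) : ((∑ i, (v i).natAbs : ℕ) : ℝ) ≤ k * ‖v‖ := by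
  have h : ∀ i ∈ (univ : Finset (Fin (k - 1))), (((v i).natAbs : ℕ) : ℝ) ≤ ‖v‖ := fun i _ => by
    rw [Nat.cast_natAbs, Int.cast_abs]
    exact abs_coord_le_norm v i
  rw [Nat.cast_sum]
  refine (sum_le_sum h).trans ?_
  rw [sum_const, card_univ, Fintype.card_fin, nsmul_eq_mul]
  gcongr
  omega

theorem one_le_norm {v : Vec k} (hv : v ≠ 0) : 1 ≤ ‖v‖ := by
  obtain ⟨i, hi⟩ := Function.ne_iff.mp hv
  refine le_trans ?_ (abs_coord_le_norm v i)
  have : (1 : ℤ) ≤ |v i| := Int.one_le_abs hi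
  exact_mod_cast this

theorem table_size_le {t s : ℕ} (hs : 1 ≤ s) (ht : 2 ^ t ≤ 2 * s) :
    ((t + 1 : ℕ) : ℝ) ≤ 2 * (1 + Real.log s) := by
  have h2 := Real.log_two_gt_d9
  have hs' : (1 : ℝ) ≤ s := by exact_mod_cast hs
  have h : ((2 : ℝ)) ^ t ≤ 2 * s := by exact_mod_cast ht
  have h3 := Real.log_le_log (by positivity) h
  rw [Real.log_pow, Real.log_mul (by norm_num) (by positivity)] at h3
  have h4 := Real.log_nonneg hs'
  push_cast
  by_contra! hcon
  have h5 : (2 * (1 + Real.log s) - 1) * Real.log 2 < t * Real.log 2 :=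
    mul_lt_mul_of_pos_right (by linarith) (by linarith)
  nlinarith

theorem log_sqNorm_le (hk : 2 ≤ k) : ∃ C : ℝ, 0 < C ∧ ∀ v : Vec k, 2 ≤ ‖v‖ →
    2 * (1 + Real.log (sqNorm v)) ≤ C * Real.log ‖v‖ := by
  have hk' : (2 : ℝ) ≤ k := by exact_mod_cast hk
  have h2 := Real.log_two_gt_d9
  have hlk : 0 < Real.log k := Real.log_pos (by linarith)
  refine ⟨4 * (1 + Real.log k) + 4, by positivity, fun v hv => ?_⟩
  have hv0 : v ≠ 0 := by
    rintro rfl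
    rw [norm_zero] at hv
    norm_num at hv
  have hs : (1 : ℝ) ≤ sqNorm v := by exact_mod_cast sqNorm_pos hv0
  have h3 := Real.log_le_log (by linarith) (sqNorm_le_norm v)
  rw [Real.log_mul (by positivity) (by positivity), Real.log_pow] at h3
  have h4 : Real.log 2 ≤ Real.log ‖v‖ := Real.log_le_log (by norm_num) hv
  push_cast at h3
  nlinarith

theorem half_le_log {x : ℝ} (hx : 2 ≤ x) : 1 / 2 ≤ Real.log x := by
  have h2 := Real.log_two_gt_d9
  have := Real.log_le_log (by norm_num) hx
  linarith

/-! ### The number of rounds -/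

/-- For every `k`, the number of rounds times the cost of a round is linear in the norm. -/
theorem exists_rounds_mul_log_le (hk : 2 ≤ k) :
    ∃ C : ℝ, 0 < C ∧ ∀ (v : Vec k) (l : List ℕ) (w : Vec k), v ≠ 0 → Rounds v l w →
      (1 + Real.log (sqNorm v)) * (l.length + 1) ≤ C * √(sqNorm v) := by
  obtain ⟨c, R, hc, hshort⟩ := exists_shortening hk
  set R' := max R 2 with hR'
  refine ⟨(R' : ℝ) ^ 4 * ((R' : ℝ) ^ 4 + 1) + (20 + 20 / c), by positivity,
    fun v l w hv hrun => ?_⟩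
  set s := sqNorm v with hs
  have hs1 : 1 ≤ s := sqNorm_pos hv
  have hs1' : (1 : ℝ) ≤ s := by exact_mod_cast hs1
  have hsq1 : 1 ≤ √(s : ℝ) := Real.one_le_sqrt.mpr hs1'
  have hlogs := Real.log_nonneg hs1'
  -- The threshold s^{1/4} is small enough for Θ log s to be O(√s), yet its logarithm is comparable
  -- to log s.
  set Θ := Nat.sqrt (Nat.sqrt s) with hΘ
  have hlt : s < (Θ + 1) ^ 4 := by
    have h1 : s < (Nat.sqrt s + 1) ^ 2 := Nat.lt_succ_sqrt' s
    have h2 : Nat.sqrt s < (Θ + 1) ^ 2 := Nat.lt_succ_sqrt' _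
    calc s < (Nat.sqrt s + 1) ^ 2 := h1
      _ ≤ ((Θ + 1) ^ 2) ^ 2 := Nat.pow_le_pow_left h2 2
      _ = _ := by ring
  have hlen := fun (Φ : ℕ → ℝ) h1 h2 Θ h3 => hrun.length_le Φ h1 h2 Θ h3
  rcases lt_or_ge Θ R' with hsmall | hbig
  · have hsR : s ≤ R' ^ 4 := hlt.le.trans (Nat.pow_le_pow_left hsmall 4)
    have hl : l.length ≤ s := by
      refine (hlen (fun s => s) (fun a b h => Nat.cast_le.mpr h) (fun s => by positivity) R'
        fun u hu => ?_).2
      obtain ⟨n, hn1, hn2⟩ := hshort u ((le_max_left R 2).trans hu.le)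
      have hu2 : 2 < sqNorm u := lt_of_le_of_lt (le_max_right R 2) hu
      have hu2' : (2 : ℝ) < sqNorm u := by exact_mod_cast hu2
      have hpos : 0 < c * √(sqNorm u) * Real.log (sqNorm u) :=
        mul_pos (mul_pos hc (Real.sqrt_pos.mpr (by linarith))) (Real.log_pos (by linarith))
      have : sqNorm (u - bonacciVec k n) < sqNorm u := by
        have : (sqNorm (u - bonacciVec k n) : ℝ) < sqNorm u := by linarith
        exact_mod_cast this
      exact ⟨n, hn1, by exact_mod_cast this⟩
    have hl' : (l.length : ℝ) ≤ (R' : ℝ) ^ 4 := by exact_mod_cast hl.trans hsR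
    have hlog : 1 + Real.log s ≤ (R' : ℝ) ^ 4 := by
      have h1 := Real.log_le_sub_one_of_pos (by linarith : (0 : ℝ) < s)
      have h2 : (s : ℝ) ≤ (R' : ℝ) ^ 4 := by exact_mod_cast hsR
      linarith
    calc (1 + Real.log s) * (l.length + 1) ≤ (R' : ℝ) ^ 4 * ((R' : ℝ) ^ 4 + 1) := by gcongr
      _ ≤ ((R' : ℝ) ^ 4 * ((R' : ℝ) ^ 4 + 1) + (20 + 20 / c)) * 1 := by
          have : 0 < 20 / c := by positivity
          linarith
      _ ≤ _ := by gcongr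
  · have hΘ2 : 2 ≤ Θ := (le_max_right R 2).trans hbig
    have hΘ2' : (2 : ℝ) ≤ Θ := by exact_mod_cast hΘ2
    set lam := Real.log Θ with hlam
    have hlam0 : 1 / 2 ≤ lam := half_le_log hΘ2'
    have hΘsq : (Θ : ℝ) ^ 2 ≤ √s := by
      apply Real.le_sqrt_of_sq_le
      have h1 : Θ ^ 2 ≤ Nat.sqrt s := Nat.sqrt_le' _
      have h2 : Nat.sqrt s ^ 2 ≤ s := Nat.sqrt_le' _
      have h3 : (Θ ^ 2) ^ 2 ≤ s := (Nat.pow_le_pow_left h1 2).trans h2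
      exact_mod_cast h3
    have hlogle : Real.log s ≤ 8 * lam := by
      have h1 : s ≤ Θ ^ 8 := by
        refine hlt.le.trans ?_
        calc (Θ + 1) ^ 4 ≤ (Θ ^ 2) ^ 4 := Nat.pow_le_pow_left (by nlinarith) 4
          _ = _ := by ring
      have h2 : (s : ℝ) ≤ (Θ : ℝ) ^ 8 := by exact_mod_cast h1
      have h3 := Real.log_le_log (by linarith) h2
      rwa [Real.log_pow] at h3
    -- While the squared norm exceeds Θ, its logarithm is at least λ = log Θ, so every round lowers
    -- the norm by at least cλ/2, one unit of this potential.
    have hl := (hlen (fun x => 2 * √x / (c * lam))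
      (fun a b h => by
        have : √(a : ℝ) ≤ √(b : ℝ) := Real.sqrt_le_sqrt (by exact_mod_cast h)
        simp only
        gcongr) (fun x => by positivity) Θ fun u hu => ?_).1
    · have hlamΘ : lam ≤ Θ := by
        have := Real.log_le_sub_one_of_pos (by linarith : (0 : ℝ) < Θ)
        linarith
      have h1 : (1 + Real.log s) * (l.length + 1)
          ≤ (10 * lam) * (Θ + 1 + 2 * √s / (c * lam) + 1) := by
        refine mul_le_mul (by linarith) (by linarith) (by positivity) (by linarith)
      have h2 : (10 * lam) * (Θ + 1 + 2 * √s / (c * lam) + 1)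
          = 10 * lam * (Θ + 2) + 20 / c * √s := by
        have : lam ≠ 0 := by linarith
        field_simp
        ring
      have h3 : 10 * lam * (Θ + 2) ≤ 20 * √s := by nlinarith
      have h4 : 0 ≤ (R' : ℝ) ^ 4 * ((R' : ℝ) ^ 4 + 1) * √s := by positivity
      linarith
    · obtain ⟨n, hn1, hn2⟩ := hshort u (((le_max_left R 2).trans hbig).trans hu.le)
      refine ⟨n, hn1, ?_⟩
      have huΘ : (Θ : ℝ) ≤ sqNorm u := by exact_mod_cast hu.le
      have hloglam : lam ≤ Real.log (sqNorm u) := Real.log_le_log (by linarith) huΘ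
      set x := √(sqNorm u : ℝ) with hx
      have hx0 : 0 < x := Real.sqrt_pos.mpr (by linarith)
      have hxx : x ^ 2 = sqNorm u := Real.sq_sqrt (by linarith)
      set L := Real.log (sqNorm u) with hL
      have hnn : (0 : ℝ) ≤ sqNorm (u - bonacciVec k n) := by positivity
      have hcL : 0 < c * L := mul_pos hc (by linarith)
      -- A squared norm cannot become negative, which forces cL ≤ x. Hence x - cL/2 is nonnegative,
      -- and its square dominates x² - cxL.
      have hxL : c * L ≤ x := by
        have h1 : 0 ≤ x * (x - c * L) := by
          rw [← hxx] at hn2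
          linarith
        have := nonneg_of_mul_nonneg_right h1 hx0
        linarith
      have hsqrt : √(sqNorm (u - bonacciVec k n) : ℝ) ≤ x - c / 2 * L := by
        rw [Real.sqrt_le_left (by linarith)]
        rw [← hxx] at hn2
        nlinarith [sq_nonneg (c / 2 * L)]
      have hden : 0 < c * lam := mul_pos hc (by linarith)
      rw [div_add_one hden.ne', div_le_div_iff_of_pos_right hden]
      have := mul_le_mul_of_nonneg_left hloglam hc.le
      linarith

/-- For `k ≤ 3`, the number of rounds is logarithmic, and the vector that is left is bounded. -/
theorem exists_rounds_le_log (hk : 2 ≤ k) (hk3 : k ≤ 3) :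
    ∃ C : ℝ, 0 < C ∧ ∀ (v : Vec k) (l : List ℕ) (w : Vec k), v ≠ 0 → Rounds v l w →
      (l.length + 1 : ℝ) ≤ C * (2 * (1 + Real.log (sqNorm v))) ∧ √(sqNorm w) ≤ C := by
  obtain ⟨ε, R, hε0, hε1, hshort⟩ := exists_shortening_factor hk hk3
  set δ := -Real.log (1 - ε) with hδ
  have hδ0 : 0 < δ := neg_pos.mpr (Real.log_neg (by linarith) (by linarith))
  -- This covers a step that reaches the zero vector: `Real.log 0 = 0`, so the unit drop of log x /
  -- δ has to come from log ‖u‖² ≥ δ.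
  obtain ⟨Q, hQ⟩ := exists_nat_gt (Real.exp δ)
  set Θ := max R Q with hΘ
  refine ⟨Θ + 2 + δ⁻¹ + R, by positivity, fun v l w hv hrun => ⟨?_, ?_⟩⟩
  · have hs1' : (1 : ℝ) ≤ sqNorm v := by exact_mod_cast sqNorm_pos hv
    have hlogs := Real.log_nonneg hs1'
    have hl := (hrun.length_le (fun x => Real.log x / δ) (fun a b h => ?_)
      (fun x => div_nonneg (Real.log_natCast_nonneg x) hδ0.le) Θ fun u hu => ?_).1
    · have h1 : Real.log (sqNorm v) / δ = δ⁻¹ * Real.log (sqNorm v) := by ring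
      rw [h1] at hl
      have h2 : 0 ≤ ((Θ : ℝ) + 2 + R) * Real.log (sqNorm v) := by positivity
      have h3 : 0 ≤ δ⁻¹ * Real.log (sqNorm v) := by positivity
      have h4 : 0 < δ⁻¹ := by positivity
      have h5 : (0 : ℝ) ≤ Θ := by positivity
      have h6 : (0 : ℝ) ≤ R := by positivity
      nlinarith
    · rcases Nat.eq_zero_or_pos a with rfl | ha
      · simp only [Nat.cast_zero, Real.log_zero, zero_div]
        exact div_nonneg (Real.log_natCast_nonneg b) hδ0.le
      · have : Real.log a ≤ Real.log b :=
          Real.log_le_log (by exact_mod_cast ha) (by exact_mod_cast h)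
        simp only
        gcongr
    · obtain ⟨n, hn1, hn2⟩ := hshort u ((le_max_left R Q).trans hu.le)
      refine ⟨n, hn1, ?_⟩
      have huQ : (Q : ℝ) ≤ sqNorm u := by exact_mod_cast ((le_max_right R Q).trans hu.le)
      have hu0 : (0 : ℝ) < sqNorm u := by linarith [Real.exp_pos δ]
      rw [div_add_one hδ0.ne', div_le_div_iff_of_pos_right hδ0]
      rcases Nat.eq_zero_or_pos (sqNorm (u - bonacciVec k n)) with h0 | hpos
      · rw [h0, Nat.cast_zero, Real.log_zero, zero_add]
        exact ((Real.lt_log_iff_exp_lt hu0).mpr (hQ.trans_le huQ)).le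
      · have h1 := Real.log_le_log (by exact_mod_cast hpos) hn2
        rw [Real.log_mul (by linarith) hu0.ne'] at h1
        linarith
  · have hw : sqNorm w ≤ R := by
      by_contra! hcon
      obtain ⟨n, hn1, hn2⟩ := hshort w hcon.le
      have h1 : (sqNorm w : ℝ) ≤ sqNorm (w - bonacciVec k n) := by
        exact_mod_cast hrun.final_spec.2 n hn1
      have h2 : (0 : ℝ) < sqNorm w := by exact_mod_cast (by omega : 0 < sqNorm w)
      nlinarith
    have h1 : (sqNorm w : ℝ) ≤ R := by exact_mod_cast hw
    have h2 : √(sqNorm w : ℝ) ≤ R + 1 := by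
      rw [Real.sqrt_le_left (by positivity)]
      nlinarith [(by positivity : (0 : ℝ) ≤ R)]
    have h3 : 0 < δ⁻¹ := by positivity
    have h4 : (0 : ℝ) ≤ Θ := by positivity
    linarith

/-! ### The running times -/

/-- The quantity `U` (table size times rounds, plus small steps) bounds, up to constants, the cost
of j_lsb and also j_lsb itself. The greedy part is linear in j_lsb and ‖v‖₁. -/
theorem largeStepsAlgorithm_cost_le (hk : 2 ≤ k) {A : ℕ} (hA : IsTableConstant k A) :
    ∃ C : ℝ, ∀ tie, ∀ v : Vec k, v ≠ 0 →
      ((largeStepsAlgorithm k A tie v).cost : ℝ) ≤ C * ‖v‖ := by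
  obtain ⟨D, hD⟩ := computeLsb_spec hk hA
  obtain ⟨C, hC, hrounds⟩ := exists_rounds_mul_log_le hk
  refine ⟨(D + (k + 5) * D) * (2 * C * k + 2 * k * k) + (3 * k + 4) + 4 * k,
    fun tie v hv => ?_⟩
  obtain ⟨t, l, w, ht, hrun, hval, hj, hcost⟩ := hD tie v hv
  have hg := (vectorGreedy_spec hk (indexBound k (l ++ smallSteps w)) v).2
  have htot : (largeStepsAlgorithm k A tie v).cost = (computeLsb k A tie v).cost
      + (vectorGreedy k (indexBound k (l ++ smallSteps w)) v).cost := by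
    simp only [largeStepsAlgorithm, cost_bind, hval]
  have hkv := sqrt_sqNorm_le_norm hk v
  have hS : ((smallSteps w).length : ℝ) ≤ 2 * k * k * ‖v‖ := by
    have h1 : √(sqNorm w : ℝ) ≤ √(sqNorm v) :=
      Real.sqrt_le_sqrt (by exact_mod_cast hrun.final_spec.1)
    refine (smallSteps_length w).trans ?_
    have := mul_le_mul_of_nonneg_left (h1.trans hkv) (by positivity : (0 : ℝ) ≤ 2 * k)
    linarith
  have ht' := table_size_le (sqNorm_pos hv) ht
  have hU : (((t + 1) * (l.length + 1) : ℕ) : ℝ) ≤ 2 * C * k * ‖v‖ := by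
    rw [Nat.cast_mul]
    have h1 := mul_le_mul_of_nonneg_right ht' (by positivity : (0 : ℝ) ≤ (l.length + 1 : ℕ))
    have h2 := hrounds v l w hv hrun
    have h3 := mul_le_mul_of_nonneg_left hkv hC.le
    push_cast at h1 h2 ⊢
    linarith
  have hUj : t + 1 + l.length + (smallSteps w).length
      ≤ (t + 1) * (l.length + 1) + (smallSteps w).length := by
    have : (t + 1) * (l.length + 1) = t * l.length + t + l.length + 1 := by ring
    have h0 := Nat.zero_le (t * l.length)
    omega
  set U := (t + 1) * (l.length + 1) + (smallSteps w).length with hUdef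
  have hUle : (U : ℝ) ≤ (2 * C * k + 2 * k * k) * ‖v‖ := by
    rw [hUdef, Nat.cast_add]
    linarith
  have hnat : (largeStepsAlgorithm k A tie v).cost
      ≤ (D + (k + 5) * D) * U + (3 * k + 4) + 4 * ∑ i, (v i).natAbs := by
    have h1 : (k + 5) * indexBound k (l ++ smallSteps w) ≤ (k + 5) * (D * U) :=
      Nat.mul_le_mul_left _ (hj.trans (Nat.mul_le_mul_left _ hUj))
    rw [htot, add_mul, mul_assoc]
    omega
  have hreal : ((largeStepsAlgorithm k A tie v).cost : ℝ)
      ≤ (D + (k + 5) * D) * U + (3 * k + 4) + 4 * ((∑ i, (v i).natAbs : ℕ) : ℝ) := by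
    exact_mod_cast hnat
  have h1 := mul_le_mul_of_nonneg_left hUle (by positivity : (0 : ℝ) ≤ D + (k + 5) * D)
  have h2 := sum_natAbs_le_norm v
  have h3 := mul_le_mul_of_nonneg_left (one_le_norm hv) (by positivity : (0 : ℝ) ≤ 3 * k + 4)
  linarith

theorem ne_zero_of_two_le_norm {v : Vec k} (hv : 2 ≤ ‖v‖) : v ≠ 0 := by
  rintro rfl
  rw [norm_zero] at hv
  norm_num at hv

/-- From k(N - 1) ≤ j_lsb, rounds and small steps together number at most j_lsb + 1, and each round
scans a table of logarithmic size. -/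
theorem computeLsb_cost_le_of_index_le (hk : 2 ≤ k) {A : ℕ} (hA : IsTableConstant k A) (c : ℝ) :
    ∃ C : ℝ, ∀ tie, ∀ v : Vec k, 2 ≤ ‖v‖ →
      ((computeLsb k A tie v).val.2 : ℝ) ≤ c * Real.log ‖v‖ →
      ((computeLsb k A tie v).cost : ℝ) ≤ C * Real.log ‖v‖ ^ 2 := by
  obtain ⟨D, hD⟩ := computeLsb_spec hk hA
  obtain ⟨C, hC, hlog⟩ := log_sqNorm_le hk
  refine ⟨D * (C + 2) * (|c| + 4), fun tie v hv hidx => ?_⟩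
  have hv0 := ne_zero_of_two_le_norm hv
  obtain ⟨t, l, w, ht, hrun, hval, -, hcost⟩ := hD tie v hv0
  have hℓ := half_le_log hv
  set ℓ := Real.log ‖v‖ with hℓdef
  have ht' := (table_size_le (sqNorm_pos hv0) ht).trans (hlog v hv)
  have hN : l.length + (smallSteps w).length ≤ (computeLsb k A tie v).val.2 + 1 := by
    rw [hval]
    simp only [indexBound, List.length_append]
    have : l.length + (smallSteps w).length - 1
        ≤ k * (l.length + (smallSteps w).length - 1) := Nat.le_mul_of_pos_left _ (by omega)
    omega
  have hN' : (l.length : ℝ) + (smallSteps w).length ≤ (computeLsb k A tie v).val.2 + 1 := by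
    exact_mod_cast hN
  have hcabs : c * ℓ ≤ |c| * ℓ := mul_le_mul_of_nonneg_right (le_abs_self c) (by linarith)
  have hl : (l.length : ℝ) + 1 ≤ (|c| + 4) * ℓ := by
    have : (0 : ℝ) ≤ (smallSteps w).length := by positivity
    linarith
  have hS : ((smallSteps w).length : ℝ) ≤ (|c| + 4) * ℓ := by
    have : (0 : ℝ) ≤ l.length := by positivity
    linarith
  have hreal : ((computeLsb k A tie v).cost : ℝ)
      ≤ D * (((t + 1 : ℕ) : ℝ) * (l.length + 1) + (smallSteps w).length) := by
    exact_mod_cast hcost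
  refine hreal.trans ?_
  have h1 : ((t + 1 : ℕ) : ℝ) * (l.length + 1) ≤ (C * ℓ) * ((|c| + 4) * ℓ) :=
    mul_le_mul ht' hl (by positivity) (by positivity)
  have h2 : (|c| + 4) * ℓ ≤ 2 * ℓ * ((|c| + 4) * ℓ) :=
    le_mul_of_one_le_left (by positivity) (by linarith)
  have h3 : ((t + 1 : ℕ) : ℝ) * (l.length + 1) + (smallSteps w).length
      ≤ (C + 2) * (|c| + 4) * ℓ ^ 2 := by linarith
  have := mul_le_mul_of_nonneg_left h3 (by positivity : (0 : ℝ) ≤ D)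
  linarith

/-- Logarithmically many rounds meet a table of logarithmic size, and the small steps are bounded in
number. -/
theorem computeLsb_cost_le_of_le_three (hk : 2 ≤ k) (hk3 : k ≤ 3) {A : ℕ}
    (hA : IsTableConstant k A) :
    ∃ C : ℝ, ∀ tie, ∀ v : Vec k, 2 ≤ ‖v‖ →
      ((computeLsb k A tie v).cost : ℝ) ≤ C * Real.log ‖v‖ ^ 2 := by
  obtain ⟨D, hD⟩ := computeLsb_spec hk hA
  obtain ⟨C, hC, hlog⟩ := log_sqNorm_le hk
  obtain ⟨E, hE, hrounds⟩ := exists_rounds_le_log hk hk3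
  refine ⟨D * (C * (E * C) + 8 * k * E), fun tie v hv => ?_⟩
  have hv0 := ne_zero_of_two_le_norm hv
  obtain ⟨t, l, w, ht, hrun, -, -, hcost⟩ := hD tie v hv0
  have hℓ := half_le_log hv
  have hlogv := hlog v hv
  set ℓ := Real.log ‖v‖ with hℓdef
  have ht' := (table_size_le (sqNorm_pos hv0) ht).trans hlogv
  obtain ⟨hr1, hr2⟩ := hrounds v l w hv0 hrun
  have hl : (l.length : ℝ) + 1 ≤ E * (C * ℓ) :=
    hr1.trans (mul_le_mul_of_nonneg_left hlogv hE.le)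
  have hS : ((smallSteps w).length : ℝ) ≤ 2 * k * E :=
    (smallSteps_length w).trans (mul_le_mul_of_nonneg_left hr2 (by positivity))
  have hreal : ((computeLsb k A tie v).cost : ℝ)
      ≤ D * (((t + 1 : ℕ) : ℝ) * (l.length + 1) + (smallSteps w).length) := by
    exact_mod_cast hcost
  refine hreal.trans ?_
  have h1 : ((t + 1 : ℕ) : ℝ) * (l.length + 1) ≤ (C * ℓ) * (E * (C * ℓ)) :=
    mul_le_mul ht' hl (by positivity) (by positivity)
  have h2 : 2 * k * E ≤ 2 * k * E * (4 * ℓ ^ 2) :=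
    le_mul_of_one_le_right (by positivity) (by nlinarith)
  have h3 : ((t + 1 : ℕ) : ℝ) * (l.length + 1) + (smallSteps w).length
      ≤ (C * (E * C) + 8 * k * E) * ℓ ^ 2 := by linarith
  have := mul_le_mul_of_nonneg_left h3 (by positivity : (0 : ℝ) ≤ D)
  linarith

end LargeSteps

theorem mainTheorem12 (k : ℕ) (hk : 2 ≤ k) :
    ∃ A : ℕ,
      -- the program computes what it should, and its runs are all the runs of the procedure
      (∀ v : LargeSteps.Vec k, v ≠ 0 → ∀ (ns : List ℕ) (j : ℕ),
        (LargeSteps.LargeStepsRun v ns ∧ j = LargeSteps.indexBound k ns) ↔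
          ∃ tie, (LargeSteps.computeLsb k A tie v).val = (ns, j)) ∧
      (∀ tie, ∀ v : LargeSteps.Vec k, v ≠ 0 →
        LargeSteps.IsVectorGreedyOutput k (LargeSteps.computeLsb k A tie v).val.2 v
          (LargeSteps.largeStepsAlgorithm k A tie v).val) ∧
      -- the whole algorithm takes `O(‖v‖_∞)` operations
      (∃ C : ℝ, ∀ tie, ∀ v : LargeSteps.Vec k, v ≠ 0 →
        ((LargeSteps.largeStepsAlgorithm k A tie v).cost : ℝ) ≤ C * ‖v‖) ∧
      -- where `j_lsb = O(log ‖v‖_∞)`, computing it takes `O((log ‖v‖_∞)^2)` operations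
      (∀ c : ℝ, ∃ C : ℝ, ∀ tie, ∀ v : LargeSteps.Vec k, 2 ≤ ‖v‖ →
        ((LargeSteps.computeLsb k A tie v).val.2 : ℝ) ≤ c * Real.log ‖v‖ →
        ((LargeSteps.computeLsb k A tie v).cost : ℝ) ≤ C * Real.log ‖v‖ ^ 2) ∧
      -- for `k = 2` and `k = 3` this holds for all `v`
      (k ≤ 3 → ∃ C : ℝ, ∀ tie, ∀ v : LargeSteps.Vec k, 2 ≤ ‖v‖ →
        ((LargeSteps.computeLsb k A tie v).cost : ℝ) ≤ C * Real.log ‖v‖ ^ 2) := by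
  obtain ⟨A, hA⟩ := LargeSteps.exists_table_constant hk
  exact ⟨A, fun v hv ns j => LargeSteps.largeStepsRun_iff_computeLsb hk hA hv ns j,
    fun tie v _ => (LargeSteps.vectorGreedy_spec hk _ v).1,
    LargeSteps.largeStepsAlgorithm_cost_le hk hA,
    LargeSteps.computeLsb_cost_le_of_index_le hk hA,
    fun hk3 => LargeSteps.computeLsb_cost_le_of_le_three hk hk3 hA⟩
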